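/- Let $\mathfrak c = 2^{\aleph_0}$, and assume Martin's axiom for $\sigma$-centered posets: for every nonempty poset $\mathbb P$ that is a union of countably many centered subsets (a subset is centered if any finitely many of its elements have a lower bound in $\mathbb P$) and every family $\mathscr X$ of fewer than $\mathfrak c$ dense subsets of $\mathbb P$, there is a filter $G \subseteq \mathbb P$ with $G \cap D \neq \emptyset$ for all $D \in \mathscr X$. A P-point is a non-principal ultrafilter $\mathcal U$ on $\omega$ such that every $f : \omega \to \omega$ is finite-to-one or constant on some set in $\mathcal U$. For ultrafilters $\mathcal U, \mathcal V$ on $\omega$, write $\mathcal U \leq_{RK} \mathcal V$ if there is $f : \omega \to \omega$ such that for all $a \subseteq \omega$, $a \in \mathcal U$ if and only if $f^{-1}(a) \in \mathcal V$; and write $\mathcal U \leq_T \mathcal V$ if there is a map $g : \mathcal V \to \mathcal U$ sending every cofinal subset of $\langle \mathcal V, \supseteq \rangle$ to a cofinal subset of $\langle \mathcal U, \supseteq \rangle$. Then for every partial order $\langle P, \leq \rangle$ with $|P| \leq \mathfrak c$ there is a family $\langle \mathcal U_p : p \in P \rangle$ of P-points such that for all $p, q \in P$, $$p \leq q \iff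 \mathcal U_p \leq_{RK} \mathcal U_q \iff \mathcal U_p \leq_T \mathcal U_q .$$ -/

import Mathlib

namespace PPoints

/-- A subset of a poset is centered if any finitely many of its elements have a lower bound
in the poset. -/
def IsCentered {P : Type*} [Preorder P] (X : Set P) : Prop :=
  ∀ F : Finset P, (F : Set P) ⊆ X → ∃ p : P, ∀ q ∈ F, p ≤ q

/-- A poset is `σ`-centered if it is a countable union of centered subsets. -/
def IsSigmaCentered (P : Type*) [Preorder P] : Prop :=
  ∃ C : ℕ → Set P, (∀ n, IsCentered (C n)) ∧ (⋃ n, C n) = Set.univ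

/-- Density in the sense of forcing: every condition has an extension in `D`. -/
def IsDenseSubset {P : Type*} [Preorder P] (D : Set P) : Prop :=
  ∀ p : P, ∃ q ∈ D, q ≤ p

/-- Martin's axiom for `σ`-centered posets: every family of fewer than `𝔠` dense subsets of a
nonempty `σ`-centered poset is met by a filter. -/
def MASigmaCentered : Prop :=
  ∀ (P : Type) [PartialOrder P] [Nonempty P], IsSigmaCentered P →
    ∀ X : Set (Set P), Cardinal.mk X < Cardinal.continuum → (∀ D ∈ X, IsDenseSubset D) →
      ∃ G : Order.PFilter P, ∀ D ∈ X, ((G : Set P) ∩ D).Nonempty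

/-- A P-point: a non-principal ultrafilter `U` on `ℕ` such that every `f : ℕ → ℕ` is
finite-to-one or constant on a set in `U`. -/
def IsPPoint (U : Ultrafilter ℕ) : Prop :=
  (U : Filter ℕ) ≤ Filter.cofinite ∧
    ∀ f : ℕ → ℕ, ∃ A ∈ U,
      (∀ n : ℕ, {k ∈ A | f k = n}.Finite) ∨ (∃ c : ℕ, ∀ k ∈ A, f k = c)

/-- Rudin–Keisler reducibility of a filter `F` on `X` to a filter `G` on `Y`. -/
def RKReducible {X Y : Type*} (F : Filter X) (G : Filter Y) : Prop :=
  ∃ f : Y → X, ∀ a : Set X, a ∈ F ↔ f ⁻¹' a ∈ G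

/-- Tukey reducibility of `D` to `E`: there is a convergent map `E → D`, that is, a map under
which the image of every cofinal set is cofinal. -/
def TukeyReducible (D E : Type*) [Preorder D] [Preorder E] : Prop :=
  ∃ g : E → D, ∀ C : Set E, IsCofinal C → IsCofinal (g '' C)

/-- An ultrafilter on `ℕ` as a directed set, ordered by reverse inclusion. -/
abbrev DirectedSet (U : Ultrafilter ℕ) : Type :=
  {a : (Set ℕ)ᵒᵈ // OrderDual.ofDual a ∈ U}

end PPoints

/-! ### Martin's axiom for working parts with finite sets of promises. -/

namespace PPoints

open Cardinal

/-! Add a top to the order to get `J`, and build one ultrafilter `U` on `ℕ` with projections `G p`,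
`p ∈ J`, where `G ⊤ = id`; the P-points are the images of `U` under `G p`. If `p < q`, then `G p`
factors through `G q` on a set in `U`, which gives Rudin–Keisler and hence Tukey reducibility. The
content is that `p ≰ q` excludes Tukey reductions of `U_p` to `U_q`.

Since `U_q` is a P-point, such a reduction is coded by a monotone `ψ : Finset ℕ → Set ℕ`
(`TukeyReducible.exists_finitary`). There are only `𝔠` such maps, so each can be defeated in a
recursion of length `𝔠`: put into `U` a set `A` such that every nonempty `ψ s` with `s ⊆ G q '' A`
has a point outside `G p '' A`. The sets `A` are also pseudo-intersections of what came before,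
which makes `U` a P-point.

The recursion keeps the invariant `Rich`: finite intersections of chosen sets contain large cubes,
on which `G q` records exactly the coordinates below `q`. Deciding a set preserves it by the product
Ramsey theorem. Adjoining a projection or a diagonalizing set uses Martin's axiom with finite
approximations; the density arguments are `Rich.exists_extension_new_index` and
`Rich.exists_extension_diagonal`. The latter works because, when `p ≰ q`, moving the coordinate `p`
changes `G p` but not `G q`. -/

/-- Martin's axiom for `σ`-centered posets, for preorders. -/
theorem MASigmaCentered.exists_directed_of_preorder (hMA : MASigmaCentered) {P : Type}
    [Preorder P] [Nonempty P] (hP : IsSigmaCentered P) {ι : Type} (hι : #ι < continuum)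
    (D : ι → Set P) (hD : ∀ i, IsDenseSubset (D i)) :
    ∃ G : Set P, DirectedOn (· ≥ ·) G ∧ ∀ i, (G ∩ D i).Nonempty := by
  let A := Antisymmetrization P (· ≤ ·)
  let mkA : P → A := toAntisymmetrization (· ≤ ·)
  have hle : ∀ p q : P, mkA p ≤ mkA q ↔ p ≤ q := fun p q =>
    toAntisymmetrization_le_toAntisymmetrization_iff
  have hsurj : Function.Surjective mkA := Quotient.mk_surjective
  have : Nonempty A := ⟨mkA (Classical.arbitrary P)⟩
  have hA : IsSigmaCentered A := by
    classical
    obtain ⟨C, hC, hU⟩ := hP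
    refine ⟨fun n => mkA '' C n, fun n F hF => ?_, ?_⟩
    · choose f hf using fun x : F => hF x.2
      obtain ⟨p, hp⟩ := hC n (F.attach.image f) (by
        intro y hy
        simp only [Finset.coe_image, Set.mem_image] at hy
        obtain ⟨x, -, rfl⟩ := hy
        exact (hf x).1)
      refine ⟨mkA p, fun q hq => ?_⟩
      have := hp (f ⟨q, hq⟩) (Finset.mem_image_of_mem _ (Finset.mem_attach _ _))
      exact ((hle _ _).2 this).trans_eq (hf ⟨q, hq⟩).2
    · rw [← Set.image_iUnion, hU, Set.image_univ, hsurj.range_eq]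
  obtain ⟨G, hG⟩ := hMA A hA (Set.range fun i => mkA '' D i)
    (lt_of_le_of_lt mk_range_le hι) (by
      rintro _ ⟨i, rfl⟩ a
      obtain ⟨p, rfl⟩ := hsurj a
      obtain ⟨q, hq, hqp⟩ := hD i p
      exact ⟨mkA q, Set.mem_image_of_mem _ hq, (hle _ _).2 hqp⟩)
  refine ⟨mkA ⁻¹' (G : Set A), ?_, fun i => ?_⟩
  · intro p hp q hq
    obtain ⟨r, hr, hrp, hrq⟩ := G.directed _ hp _ hq
    obtain ⟨r, rfl⟩ := hsurj r
    exact ⟨r, hr, (hle _ _).1 hrp, (hle _ _).1 hrq⟩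
  · obtain ⟨_, h1, p, hp, rfl⟩ := hG _ ⟨i, rfl⟩
    exact ⟨p, h1, hp⟩

/-- Conditions with a working part from a countable type and a finite set of promises. -/
structure Condition (σ κ : Type) where
  state : σ
  side : Finset κ

/-- Forcing with a countable set of working parts and fewer than `𝔠` promises: `R X s t` says that
`t` extends `s` while keeping the promises in `X`. -/
theorem MASigmaCentered.exists_generic (hMA : MASigmaCentered) {σ κ : Type} [Countable σ]
    [Nonempty σ] (hκ : #κ < continuum) (R : Finset κ → σ → σ → Prop)
    (hrefl : ∀ X s, R X s s) (htrans : ∀ X s t u, R X s t → R X t u → R X s u)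
    (hmono : ∀ X Y s t, X ⊆ Y → R Y s t → R X s t)
    (E : Finset κ → ℕ → Set σ) (hEmono : ∀ X Y N, X ⊆ Y → E Y N ⊆ E X N)
    (hE : ∀ X N s, ∃ t, R X s t ∧ t ∈ E X N) :
    ∃ G : Set (Condition σ κ),
      (∀ c ∈ G, ∀ d ∈ G, ∃ e ∈ G, R c.side c.state e.state ∧ R d.side d.state e.state) ∧
      ∀ X N, ∃ c ∈ G, X ⊆ c.side ∧ c.state ∈ E X N := by
  classical
  let _ : Preorder (Condition σ κ) :=
    { le := fun d c => c.side ⊆ d.side ∧ R c.side c.state d.state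
      le_refl := fun c => ⟨subset_rfl, hrefl _ _⟩
      le_trans := fun a b c hab hbc =>
        ⟨hbc.1.trans hab.1, htrans _ _ _ _ hbc.2 (hmono _ _ _ _ hbc.1 hab.2)⟩ }
  have le_def : ∀ c d : Condition σ κ, d ≤ c ↔ c.side ⊆ d.side ∧ R c.side c.state d.state :=
    fun _ _ => Iff.rfl
  have : Nonempty (Condition σ κ) := ⟨⟨Classical.arbitrary σ, ∅⟩⟩
  obtain ⟨f, hf⟩ := exists_surjective_nat σ
  have hcent : IsSigmaCentered (Condition σ κ) := by
    -- Finitely many conditions with the same working part are all extended by that working part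
    -- with the union of their promises.
    refine ⟨fun n => {c | c.state = f n}, fun n F hF => ?_, ?_⟩
    · refine ⟨⟨f n, F.sup Condition.side⟩, fun q hq => ?_⟩
      have h : q.state = f n := hF hq
      refine (le_def _ _).2 ⟨Finset.le_sup (f := Condition.side) hq, ?_⟩
      simp only [h, hrefl]
    · refine Set.eq_univ_of_forall fun c => ?_
      obtain ⟨n, hn⟩ := hf c.state
      exact Set.mem_iUnion.2 ⟨n, hn.symm⟩
  have hcard : #(Finset κ × ℕ) < continuum := by
    rw [mk_prod, lift_id, lift_id, mk_nat]
    refine mul_lt_of_lt aleph0_le_continuum ?_ aleph0_lt_continuum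
    rcases finite_or_infinite κ with h | h
    · exact lt_of_lt_of_le (lt_aleph0_of_finite _) aleph0_le_continuum
    · rwa [mk_finset_of_infinite]
  obtain ⟨G, hG, hGD⟩ := hMA.exists_directed_of_preorder hcent hcard
    (fun i => {c | i.1 ⊆ c.side ∧ c.state ∈ E i.1 i.2}) (by
      rintro ⟨X, N⟩ c
      obtain ⟨t, ht, htE⟩ := hE (c.side ∪ X) N c.state
      exact ⟨⟨t, c.side ∪ X⟩, ⟨Finset.subset_union_right,
        hEmono _ _ N Finset.subset_union_right htE⟩,
        Finset.subset_union_left, hmono _ _ _ _ Finset.subset_union_left ht⟩)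
  refine ⟨G, fun c hc d hd => ?_, fun X N => ?_⟩
  · obtain ⟨e, he, hec, hed⟩ := hG c hc d hd
    exact ⟨e, he, hec.2, hed.2⟩
  · obtain ⟨c, hc, h⟩ := hGD (X, N)
    exact ⟨c, hc, h⟩

end PPoints

/-! ### Transfinite recursion of length `𝔠` with bookkeeping. -/

namespace PPoints

open Cardinal

/-- A recursion of length `𝔠` with bookkeeping: the resulting set is closed under all tasks, each
performed after any prescribed countable part has been put in. -/
theorem exists_closed_under_tasks {X Task : Type} (hTask : #Task ≤ continuum)
    (Good : Set X → Prop) (R : Task → Set X → Set X → Prop) (S₀ : Set X) (hS₀ : Good S₀)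
    (hS₀c : S₀.Countable)
    (hchain : ∀ C : Set (Set X), C.Nonempty → IsChain (· ⊆ ·) C → (∀ S ∈ C, Good S) →
      Good (⋃₀ C))
    (hext : ∀ τ S, S₀ ⊆ S → Good S → #S < continuum →
      ∃ S', S ⊆ S' ∧ Good S' ∧ (S' \ S).Countable ∧ R τ S S') :
    ∃ S : Set X, S₀ ⊆ S ∧ Good S ∧ ∀ τ, ∀ D ⊆ S, D.Countable →
      ∃ T T', D ⊆ T ∧ S₀ ⊆ T ∧ T ⊆ T' ∧ T' ⊆ S ∧ Good T ∧ Good T' ∧ R τ T T' := by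
  classical
  rcases isEmpty_or_nonempty Task with hem | hne
  · exact ⟨S₀, subset_rfl, hS₀, fun τ => (hem.false τ).elim⟩
  let K := continuum.{0}.ord.ToType
  have hK : #K = continuum := mk_ord_toType _
  have hIio : ∀ a : K, #(Set.Iio a) < continuum := fun a =>
    (mk_Iio_lt a (by rw [hK]; exact (Ordinal.type_toType _).symm)).trans_eq hK
  have hKpair : #(Task × K) ≤ #K := by
    rw [mk_prod, lift_id, lift_id, hK]
    exact (mul_le_mul' hTask le_rfl).trans (continuum_mul_self).le
  have hKne : Nonempty K := by
    rw [← mk_ne_zero_iff, hK]; exact continuum_ne_zero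
  obtain ⟨e⟩ := (hKpair : Nonempty (Task × K ↪ K))
  let book : K → Task := fun a => (Function.invFun e a).1
  -- Every task recurs cofinally: its stages `e (τ, x)` are `𝔠` many, too many to fit below `a`.
  have hbook : ∀ τ a, ∃ b, a ≤ b ∧ book b = τ := by
    intro τ a
    by_contra! hcon
    have h : ∀ x : K, e (τ, x) ∈ Set.Iio a := by
      intro x
      by_contra hx
      refine hcon _ (not_lt.1 hx) ?_
      simp only [book, Function.leftInverse_invFun e.injective (τ, x)]
    have : #K ≤ #(Set.Iio a) := mk_le_of_injective (f := fun x => ⟨e (τ, x), h x⟩) (by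
      intro x y hxy
      simpa using hxy)
    exact absurd (hIio a) (not_lt.2 (hK.symm.le.trans this))
  -- The default `S` lets the recursion be defined before goodness is known; `hgood` shows that it
  -- is never used along the stages.
  let ext : Task → Set X → Set X := fun τ S =>
    if h : ∃ S', S ⊆ S' ∧ Good S' ∧ (S' \ S).Countable ∧ R τ S S' then h.choose else S
  let st : K → Set X := WellFounded.fix (wellFounded_lt (α := K))
    (fun a ih => ext (book a) (S₀ ∪ ⋃ b : Set.Iio a, ih b b.2))
  let pre : K → Set X := fun a => S₀ ∪ ⋃ b : Set.Iio a, st b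
  have hst : ∀ a, st a = ext (book a) (pre a) := fun a => WellFounded.fix_eq _ _ a
  have hext_sub : ∀ τ S, S ⊆ ext τ S := by
    intro τ S
    by_cases h : ∃ S', S ⊆ S' ∧ Good S' ∧ (S' \ S).Countable ∧ R τ S S'
    · simp only [ext, dif_pos h]; exact h.choose_spec.1
    · simp only [ext, dif_neg h]; exact subset_rfl
  have hext_cnt : ∀ τ S, (ext τ S \ S).Countable := by
    intro τ S
    by_cases h : ∃ S', S ⊆ S' ∧ Good S' ∧ (S' \ S).Countable ∧ R τ S S'
    · simp only [ext, dif_pos h]; exact h.choose_spec.2.2.1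
    · simp only [ext, dif_neg h]; simp
  have hpre_st : ∀ a, pre a ⊆ st a := fun a => by rw [hst]; exact hext_sub _ _
  have hlt : ∀ a b, a < b → st a ⊆ pre b := fun a b hab =>
    (Set.subset_iUnion (fun c : Set.Iio b => st c) ⟨a, hab⟩).trans Set.subset_union_right
  have hmono : Monotone st := by
    intro a b hab
    rcases hab.eq_or_lt with rfl | h
    · exact subset_rfl
    · exact (hlt a b h).trans (hpre_st b)
  have hpre0 : ∀ a, S₀ ⊆ pre a := fun a => Set.subset_union_left
  -- Each stage adds countably many elements, so every stage stays below `𝔠`, as `hext` requires.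
  have hcard : ∀ a, #(st a) ≤ max ℵ₀ #(Set.Iio a) ∧ #(pre a) ≤ max ℵ₀ #(Set.Iio a) := by
    intro a
    induction a using WellFoundedLT.induction with
    | _ a ih =>
    have hp : #(pre a) ≤ max ℵ₀ #(Set.Iio a) := by
      refine (mk_union_le _ _).trans (add_le_of_le (le_max_left _ _)
        ((le_aleph0_iff_set_countable.2 hS₀c).trans (le_max_left _ _)) ?_)
      refine (mk_iUnion_le _).trans (mul_le_of_le (le_max_left _ _) (le_max_right _ _) ?_)
      refine ciSup_le' fun b => (ih b b.2).1.trans (max_le_max le_rfl ?_)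
      exact mk_le_mk_of_subset (Set.Iio_subset_Iio b.2.le)
    refine ⟨?_, hp⟩
    have h : st a ⊆ pre a ∪ (ext (book a) (pre a) \ pre a) := by
      rw [hst a]; intro x hx; by_cases h : x ∈ pre a <;> simp [hx, h]
    refine (mk_le_mk_of_subset h).trans ((mk_union_le _ _).trans ?_)
    exact add_le_of_le (le_max_left _ _) hp
      ((le_aleph0_iff_set_countable.2 (hext_cnt _ _)).trans (le_max_left _ _))
  have hunion : ∀ B : Set K, (∀ b ∈ B, Good (st b)) → Good (S₀ ∪ ⋃ b : B, st b) := by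
    intro B hB
    have hS₀st : ∀ a, S₀ ⊆ st a := fun a => (hpre0 a).trans (hpre_st a)
    have h := hchain (insert S₀ (st '' B)) (Set.insert_nonempty _ _) ?_ ?_
    · rwa [Set.sUnion_insert, Set.sUnion_image, Set.biUnion_eq_iUnion] at h
    · refine IsChain.insert ?_ ?_
      · rintro _ ⟨a, -, rfl⟩ _ ⟨b, -, rfl⟩ -
        rcases le_total a b with h | h
        · exact Or.inl (hmono h)
        · exact Or.inr (hmono h)
      · rintro _ ⟨a, -, rfl⟩ -
        exact Or.inl (hS₀st a)
    · rintro _ (rfl | ⟨a, ha, rfl⟩)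
      · exact hS₀
      · exact hB a ha
  have hgood : ∀ a, Good (pre a) ∧ Good (st a) ∧ R (book a) (pre a) (st a) := by
    intro a
    induction a using WellFoundedLT.induction with
    | _ a ih =>
    have hp : Good (pre a) := hunion (Set.Iio a) fun b hb => (ih b hb).2.1
    have h := hext (book a) (pre a) (hpre0 a) hp
      ((hcard a).2.trans_lt (max_lt aleph0_lt_continuum (hIio a)))
    have h' : st a = h.choose := by
      rw [hst a]; exact dif_pos h
    rw [h']
    exact ⟨hp, h.choose_spec.2.1, h.choose_spec.2.2.2⟩
  refine ⟨S₀ ∪ ⋃ b : (Set.univ : Set K), st b, Set.subset_union_left,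
    hunion _ fun b _ => (hgood b).2.1, fun τ D hD hDc => ?_⟩
  have hbd : ∃ a, ∀ x ∈ D, x ∈ S₀ ∪ st a := by
    -- By König, `𝔠 < 𝔠 ^ cof 𝔠`, whereas `𝔠 ^ ℵ₀ = 𝔠`. Hence a countable `D` has entered by some
    -- stage.
    have hcof : ℵ₀ < Order.cof K := by
      rw [Ordinal.cof_toType]
      by_contra! h
      have h1 := lt_power_cof_ord (c := continuum.{0}) aleph0_le_continuum
      have h2 : continuum.{0} ^ continuum.{0}.ord.cof ≤ continuum ^ ℵ₀ :=
        power_le_power_left continuum_ne_zero h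
      rw [continuum_power_aleph0] at h2
      exact absurd h1 (not_lt.2 h2)
    have h : ∀ x : D, ∃ a, (x : X) ∈ S₀ ∪ st a := by
      intro x
      rcases hD x.2 with h | h
      · exact ⟨Classical.arbitrary K, Or.inl h⟩
      · obtain ⟨a, ha⟩ := Set.mem_iUnion.1 h
        exact ⟨a, Or.inr ha⟩
    choose f hf using h
    have := hDc.to_subtype
    have hnc : ¬ IsCofinal (Set.range f) := fun hc =>
      absurd ((Order.cof_le hc).trans (le_aleph0_iff_set_countable.2 (Set.countable_range f)))
        (not_le.2 hcof)
    obtain ⟨a, ha⟩ := BddAbove.of_not_isCofinal hnc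
    refine ⟨a, fun x hx => ?_⟩
    exact Set.union_subset_union_right _ (hmono (ha ⟨⟨x, hx⟩, rfl⟩)) (hf ⟨x, hx⟩)
  obtain ⟨a, ha⟩ := hbd
  obtain ⟨b, hab, rfl⟩ : ∃ b, a < b ∧ book b = τ := by
    have : NoMaxOrder K := noMaxOrder aleph0_le_continuum
    obtain ⟨a', ha'⟩ := exists_gt a
    obtain ⟨b, hb, h⟩ := hbook τ a'
    exact ⟨b, ha'.trans_le hb, h⟩
  refine ⟨pre b, st b, fun x hx => ?_, hpre0 b, hpre_st b, ?_, hgood b⟩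
  · exact Set.union_subset (hpre0 b) (hlt a b hab) (ha x hx)
  · exact (Set.subset_iUnion (fun c : (Set.univ : Set K) => st c) ⟨b, trivial⟩).trans
      Set.subset_union_right

end PPoints

/-! ### Cubes and the product Ramsey theorem. -/

namespace PPoints

open Cardinal

section Cubes

variable {J : Type}

theorem exists_injOn_of_le_card {D : Finset ℕ} {N : ℕ} (h : N ≤ D.card) :
    ∃ σ : ℕ → ℕ, (∀ n < N, σ n ∈ D) ∧ Set.InjOn σ (Set.Iio N) := by
  refine ⟨fun n => if hn : n < D.card then D.orderEmbOfFin rfl ⟨n, hn⟩ else 0, ?_, ?_⟩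
  · intro n hn
    simp only [dif_pos (hn.trans_le h)]
    exact Finset.orderEmbOfFin_mem _ _ _
  · intro m hm n hn hmn
    simp only [dif_pos ((Set.mem_Iio.1 hm).trans_le h),
      dif_pos ((Set.mem_Iio.1 hn).trans_le h)] at hmn
    simpa using (D.orderEmbOfFin rfl).injective hmn

/-- The points of the box of side `N` with coordinates in `Q`, extended by `0`. -/
noncomputable def box (Q : Finset J) (N : ℕ) : Finset (J → ℕ) := by
  classical
  exact (Finset.univ : Finset (Q → Fin N)).image fun t r => if h : r ∈ Q then (t ⟨r, h⟩ : ℕ) else 0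

theorem mem_box {Q : Finset J} {N : ℕ} {t : J → ℕ} (ht : ∀ r, t r < N) :
    open Classical in (fun r => if r ∈ Q then t r else 0) ∈ box Q N := by
  classical
  refine Finset.mem_image.2 ⟨fun r => ⟨t r, ht r⟩, Finset.mem_univ _, ?_⟩
  funext r
  by_cases h : r ∈ Q <;> simp [h]

theorem lt_of_mem_box {Q : Finset J} {N : ℕ} (hN : 0 < N) {t : J → ℕ} (ht : t ∈ box Q N) (r : J) :
    t r < N := by
  classical
  obtain ⟨u, -, rfl⟩ := Finset.mem_image.1 ht
  by_cases h : r ∈ Q <;> simp [h, hN]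

/-- The product Ramsey theorem for two colours. -/
theorem exists_monochromatic_subgrid (Q : Finset J) (N : ℕ) :
    ∃ M, ∀ col : (J → ℕ) → Prop, (∀ t t', (∀ r ∈ Q, t r = t' r) → (col t ↔ col t')) →
      ∃ σ : J → ℕ → ℕ, (∀ r n, n < N → σ r n < M) ∧ (∀ r, Set.InjOn (σ r) (Set.Iio N)) ∧
        ((∀ t : J → ℕ, (∀ r, t r < N) → col fun r => σ r (t r)) ∨
          ∀ t : J → ℕ, (∀ r, t r < N) → ¬ col fun r => σ r (t r)) := by
  classical
  induction Q using Finset.induction_on with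
  | empty =>
    refine ⟨N, fun col hcol => ⟨fun _ => id, fun _ _ h => h, fun _ => Function.injective_id.injOn, ?_⟩⟩
    by_cases h : col fun _ => 0
    · exact Or.inl fun t _ => (hcol _ _ (by simp)).1 h
    · exact Or.inr fun t _ ht => h ((hcol _ _ (by simp)).1 ht)
  | insert a Q ha ih =>
    obtain ⟨M, hM⟩ := ih
    -- `K` counts the colour patterns of a slice over the box for `Q`. Among `K * N` slices in
    -- direction `a`, some `N` share a pattern, and the induction hypothesis is applied to that
    -- common colouring.
    let K := (box Q M).powerset.card
    refine ⟨max M (K * N), fun col hcol => ?_⟩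
    let pat : ℕ → Finset (J → ℕ) := fun v => (box Q M).filter fun t => col (Function.update t a v)
    obtain ⟨B, -, hB⟩ := Finset.exists_le_card_fiber_of_mul_le_card_of_maps_to
      (s := Finset.range (K * N)) (t := (box Q M).powerset) (f := pat) (n := N)
      (fun v _ => Finset.mem_powerset.2 (Finset.filter_subset _ _)) ⟨∅, by simp⟩ (by simp [K])
    obtain ⟨τ, hτ, hτinj⟩ := exists_injOn_of_le_card hB
    have hτpat : ∀ n < N, pat (τ n) = B := fun n hn => (Finset.mem_filter.1 (hτ n hn)).2
    have hτlt : ∀ n < N, τ n < K * N := fun n hn =>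
      Finset.mem_range.1 (Finset.mem_filter.1 (hτ n hn)).1
    obtain ⟨σ, hσ, hinj, hmono⟩ := hM (fun t => col (Function.update t a (τ 0))) (by
      intro t t' h
      refine hcol _ _ fun r hr => ?_
      by_cases hra : r = a
      · subst hra; simp
      · simpa [hra] using h r (Finset.mem_of_mem_insert_of_ne hr hra))
    refine ⟨Function.update σ a τ, fun r n hn => ?_, fun r => ?_, ?_⟩
    · by_cases hra : r = a
      · subst hra; simpa using Or.inr (hτlt n hn)
      · simpa [hra] using Or.inl (hσ r n hn)
    · by_cases hra : r = a
      · subst hra; simpa using hτinj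
      · simpa [hra] using hinj r
    have key : ∀ t : J → ℕ, (∀ r, t r < N) →
        (col (fun r => Function.update σ a τ r (t r)) ↔
          col (Function.update (fun r => σ r (t r)) a (τ 0))) := by
      intro t ht
      have hN : 0 < N := (Nat.zero_le _).trans_lt (ht a)
      have hmem := mem_box (Q := Q) (t := fun r => σ r (t r)) fun r => hσ r _ (ht r)
      set u : J → ℕ := fun r => if r ∈ Q then σ r (t r) else 0 with hu
      have h1 : u ∈ pat (τ (t a)) ↔ u ∈ pat (τ 0) := by rw [hτpat _ (ht a), hτpat _ hN]
      simp only [pat, Finset.mem_filter, hmem, true_and] at h1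
      refine (hcol _ _ fun r hr => ?_).trans (h1.trans (hcol _ _ fun r hr => ?_))
      · by_cases hra : r = a
        · subst hra; simp
        · simp [hra, hu, Finset.mem_of_mem_insert_of_ne hr hra]
      · by_cases hra : r = a
        · subst hra; simp
        · simp [hra, hu, Finset.mem_of_mem_insert_of_ne hr hra]
    rcases hmono with h | h
    · exact Or.inl fun t ht => (key t ht).2 (h t ht)
    · exact Or.inr fun t ht hcon => h t ht ((key t ht).1 hcon)

variable [PartialOrder J]

/-- `c` parametrizes a `Q`-cube of side `N` in `A`: the value of `G q` at the point with
coordinates `t` carries exactly the information of the coordinates below `q`. -/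
def IsCube (G : J → ℕ → ℕ) (Q : Finset J) (N : ℕ) (A : Set ℕ) (c : (J → ℕ) → ℕ) : Prop :=
  (∀ t, (∀ r, t r < N) → c t ∈ A) ∧
    ∀ q ∈ Q, ∀ t u, (∀ r, t r < N) → (∀ r, u r < N) →
      (G q (c t) = G q (c u) ↔ ∀ r ∈ Q, r ≤ q → t r = u r)

/-- `A` contains a `Q`-cube of side `N`. -/
def HasCube (G : J → ℕ → ℕ) (Q : Finset J) (N : ℕ) (A : Set ℕ) : Prop :=
  ∃ c, IsCube G Q N A c

theorem IsCube.subcube {G : J → ℕ → ℕ} {Q : Finset J} {M N : ℕ} {A : Set ℕ} {c : (J → ℕ) → ℕ}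
    (hc : IsCube G Q M A c) {σ : J → ℕ → ℕ} (hσ : ∀ r n, n < N → σ r n < M)
    (hinj : ∀ r, Set.InjOn (σ r) (Set.Iio N)) :
    IsCube G Q N A fun t => c fun r => σ r (t r) := by
  refine ⟨fun t ht => hc.1 _ fun r => hσ r _ (ht r), fun q hq t t' ht ht' => ?_⟩
  rw [hc.2 q hq _ _ (fun r => hσ r _ (ht r)) fun r => hσ r _ (ht' r)]
  exact forall₃_congr fun r _ _ => (hinj r).eq_iff (ht r) (ht' r)

theorem IsCube.mono_set {G : J → ℕ → ℕ} {Q : Finset J} {N : ℕ} {A B : Set ℕ} {c : (J → ℕ) → ℕ}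
    (hc : IsCube G Q N A c) (hAB : ∀ t, (∀ r, t r < N) → c t ∈ B) : IsCube G Q N B c :=
  ⟨hAB, hc.2⟩

theorem HasCube.mono {G : J → ℕ → ℕ} {Q Q' : Finset J} {N N' : ℕ} {A B : Set ℕ}
    (h : HasCube G Q N A) (hQ : Q' ⊆ Q) (hN : N' ≤ N) (hAB : A ⊆ B) : HasCube G Q' N' B := by
  classical
  obtain ⟨c, hc⟩ := h
  -- Filling the coordinates outside `Q'` with `0` needs a nonempty side, so side `0` is separate.
  rcases Nat.eq_zero_or_pos N' with rfl | hpos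
  · rcases isEmpty_or_nonempty J with hJ | ⟨⟨j⟩⟩
    · obtain rfl : Q' = ∅ := Finset.eq_empty_of_isEmpty _
      exact ⟨c, fun t _ => hAB (hc.1 t fun r => (hJ.false r).elim), by simp⟩
    · exact ⟨c, fun t ht => absurd (ht j) (by simp), fun q hq t t' ht => absurd (ht j) (by simp)⟩
  have hlt : ∀ t : J → ℕ, (∀ r, t r < N') → ∀ r, (if r ∈ Q' then t r else 0) < N := by
    intro t ht r
    split_ifs
    · exact (ht r).trans_le hN
    · exact hpos.trans_le hN
  refine ⟨fun t => c fun r => if r ∈ Q' then t r else 0, fun t ht => hAB (hc.1 _ (hlt t ht)),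
    fun q hq t t' ht ht' => ?_⟩
  rw [hc.2 q (hQ hq) _ _ (hlt t ht) (hlt t' ht')]
  constructor
  · intro h r hr hrq
    simpa [hr] using h r (hQ hr) hrq
  · intro h r _ hrq
    by_cases hr : r ∈ Q'
    · simpa [hr] using h r hr hrq
    · simp [hr]

theorem HasCube.congr {G G' : J → ℕ → ℕ} {Q : Finset J} {N : ℕ} {A : Set ℕ}
    (h : HasCube G Q N A) (hG : ∀ q ∈ Q, ∀ x ∈ A, G q x = G' q x) : HasCube G' Q N A := by
  obtain ⟨c, hc⟩ := h
  refine ⟨c, hc.1, fun q hq t t' ht ht' => ?_⟩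
  rw [← hG q hq _ (hc.1 t ht), ← hG q hq _ (hc.1 t' ht'), hc.2 q hq t t' ht ht']

/-- A cube can be thinned out in each direction so as to avoid finitely many values. -/
theorem IsCube.avoid {G : J → ℕ → ℕ} {Q : Finset J} {M N : ℕ} {A : Set ℕ} {c : (J → ℕ) → ℕ}
    (hc : IsCube G Q M A c) (Z : J → Finset ℕ) (hM : ∀ r, N + (Z r).card ≤ M) :
    ∃ σ : J → ℕ → ℕ, (∀ r n, n < N → σ r n < M) ∧ (∀ r, Set.InjOn (σ r) (Set.Iio N)) ∧
      (∀ r, Z r = ∅ → ∀ n, σ r n = n) ∧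
      ∀ q ∈ Q, ∀ t, (∀ r, t r < M) → (∃ n < N, t q = σ q n) → G q (c t) ∉ Z q := by
  classical
  have key : ∀ r, ∃ σ : ℕ → ℕ, (∀ n < N, σ n < M) ∧ Set.InjOn σ (Set.Iio N) ∧
      (Z r = ∅ → ∀ n, σ n = n) ∧ (r ∈ Q → ∀ t, (∀ r, t r < M) → (∃ n < N, t r = σ n) →
        G r (c t) ∉ Z r) := by
    intro r
    rcases (Z r).eq_empty_or_nonempty with h | h
    · exact ⟨id, fun n hn => hn.trans_le ((Nat.le_add_right _ _).trans (hM r)),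
        Function.injective_id.injOn, fun _ _ => rfl, by simp [h]⟩
    -- On the cube a value `z` of `G r` determines the coordinate `r`, so deleting the one
    -- coordinate value `ch z` suffices to avoid `z`.
    let ch : ℕ → ℕ := fun z =>
      if h : ∃ t : J → ℕ, (∀ r, t r < M) ∧ G r (c t) = z then h.choose r else 0
    obtain ⟨σ, hσ, hinj⟩ := exists_injOn_of_le_card
      (D := Finset.range M \ (Z r).image ch) (N := N) (by
        have h1 := Finset.le_card_sdiff ((Z r).image ch) (Finset.range M)
        have h2 := Finset.card_image_le (s := Z r) (f := ch)
        have h3 := hM r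
        simp only [Finset.card_range] at h1
        omega)
    refine ⟨σ, fun n hn => ?_, hinj, fun h' => (h.ne_empty h').elim, ?_⟩
    · have := hσ n hn
      simp only [Finset.mem_sdiff, Finset.mem_range] at this
      exact this.1
    · rintro hr t ht ⟨n, hn, htn⟩ hz
      have := hσ n hn
      simp only [Finset.mem_sdiff, Finset.mem_image, not_exists, not_and] at this
      refine this.2 _ hz ?_
      have hex : ∃ t' : J → ℕ, (∀ r, t' r < M) ∧ G r (c t') = G r (c t) := ⟨t, ht, rfl⟩
      simp only [ch, dif_pos hex]
      rw [← htn]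
      exact (hc.2 r hr _ _ hex.choose_spec.1 ht).1 hex.choose_spec.2 r hr le_rfl
  choose σ h1 h2 h3 h4 using key
  exact ⟨σ, h1, h2, h3, fun q hq => h4 q hq⟩

end Cubes

end PPoints

/-! ### Richness and the one-step extensions. -/

namespace PPoints

open Cardinal

section Rich

variable {J : Type} [PartialOrder J]

/-- Finite intersections of members of `W` contain arbitrarily large cubes for all finite sets of
indices from `D`. -/
def Rich (W : Set (Set ℕ)) (D : Set J) (G : J → ℕ → ℕ) : Prop :=
  ∀ F : Finset (Set ℕ), (F : Set (Set ℕ)) ⊆ W → ∀ Q : Finset J, (Q : Set J) ⊆ D →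
    ∀ N, HasCube G Q N (⋂₀ (F : Set (Set ℕ)))

theorem rich_insert {W : Set (Set ℕ)} {D : Set J} {G : J → ℕ → ℕ} {A : Set ℕ}
    (h : ∀ F : Finset (Set ℕ), (F : Set (Set ℕ)) ⊆ W → ∀ Q : Finset J, (Q : Set J) ⊆ D →
      ∀ N, HasCube G Q N (⋂₀ (F : Set (Set ℕ)) ∩ A)) : Rich (insert A W) D G := by
  classical
  intro F hF Q hQ N
  refine (h (F.erase A) ?_ Q hQ N).mono subset_rfl le_rfl ?_
  · intro B hB
    simp only [Finset.coe_erase, Set.mem_sdiff, Set.mem_singleton_iff] at hB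
    exact (hF hB.1).resolve_left hB.2
  · rintro x ⟨hx, hxA⟩ B hB
    by_cases hBA : B = A
    · rwa [hBA]
    · exact hx B (by simpa [hBA] using hB)

variable [OrderTop J]

/-- Every coordinate lies below `⊤`, and `G ⊤` is the identity. This is why `⊤` is added to each `Q`
below. -/
theorem IsCube.eq_of_eqOn {G : J → ℕ → ℕ} (hG : G ⊤ = id) {Q : Finset J} (hQ : ⊤ ∈ Q) {N : ℕ}
    {A : Set ℕ} {c : (J → ℕ) → ℕ} (hc : IsCube G Q N A c) {t t' : J → ℕ} (ht : ∀ r, t r < N)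
    (ht' : ∀ r, t' r < N) : c t = c t' ↔ ∀ r ∈ Q, t r = t' r := by
  have := hc.2 ⊤ hQ t t' ht ht'
  simpa [hG] using this

theorem IsCube.mem_image_box {G : J → ℕ → ℕ} (hG : G ⊤ = id) {Q : Finset J}
    (hQ : ⊤ ∈ Q) {N : ℕ} {A : Set ℕ} {c : (J → ℕ) → ℕ} (hc : IsCube G Q N A c) {t : J → ℕ}
    (ht : ∀ r, t r < N) : c t ∈ (box Q N).image c := by
  classical
  have hN : 0 < N := (Nat.zero_le _).trans_lt (ht ⊤)
  refine Finset.mem_image.2 ⟨_, mem_box (Q := Q) ht, ?_⟩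
  refine (hc.eq_of_eqOn hG hQ (fun r => lt_of_mem_box hN (mem_box ht) r) ht).2 fun r hr => ?_
  simp [hr]

/-- Every set can be decided. -/
theorem Rich.insert_or_insert_compl {W : Set (Set ℕ)} {D : Set J} {G : J → ℕ → ℕ}
    (h : Rich W D G) (hD : ⊤ ∈ D) (hG : G ⊤ = id) (a : Set ℕ) :
    Rich (insert a W) D G ∨ Rich (insert aᶜ W) D G := by
  classical
  by_contra! hcon
  have h1 := mt rich_insert hcon.1
  have h2 := mt rich_insert hcon.2
  push Not at h1 h2
  obtain ⟨F₁, hF₁, Q₁, hQ₁, N₁, h₁⟩ := h1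
  obtain ⟨F₂, hF₂, Q₂, hQ₂, N₂, h₂⟩ := h2
  let Q := insert ⊤ (Q₁ ∪ Q₂)
  have hQ : (Q : Set J) ⊆ D := by
    intro q hq
    simp only [Q, Finset.coe_insert, Finset.coe_union] at hq
    rcases hq with rfl | hq | hq
    exacts [hD, hQ₁ hq, hQ₂ hq]
  have htop : ⊤ ∈ Q := Finset.mem_insert_self _ _
  obtain ⟨M, hM⟩ := exists_monochromatic_subgrid Q (max N₁ N₂)
  obtain ⟨c, hc⟩ := h (F₁ ∪ F₂) (by simpa using ⟨hF₁, hF₂⟩) Q hQ M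
  obtain ⟨σ, hσ, hinj, hcol⟩ := hM
    -- The colouring must depend only on the coordinates in `Q` everywhere, but the cube controls
    -- `c` only inside its box; hence the truncation.
    (fun t => c (fun r => if t r < M then t r else 0) ∈ a) (by
      intro t t' htt'
      rcases Nat.eq_zero_or_pos M with rfl | hpos
      · simp
      have hlt : ∀ (t : J → ℕ) r, (if t r < M then t r else 0) < M := by
        intro t r; split_ifs with h <;> assumption
      have : c (fun r => if t r < M then t r else 0) = c (fun r => if t' r < M then t' r else 0) :=
        (hc.eq_of_eqOn hG htop (hlt t) (hlt t')).2 fun r hr => by rw [htt' r hr]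
      rw [this])
  have hsub := hc.subcube hσ hinj
  have hite : ∀ t : J → ℕ, (∀ r, t r < max N₁ N₂) →
      (fun r => if σ r (t r) < M then σ r (t r) else 0) = fun r => σ r (t r) := by
    intro t ht
    funext r
    rw [if_pos (hσ r _ (ht r))]
  have hsup : ∀ F ⊆ F₁ ∪ F₂, ⋂₀ ((F₁ ∪ F₂ : Finset (Set ℕ)) : Set (Set ℕ)) ⊆
      ⋂₀ (F : Set (Set ℕ)) := fun F hF => Set.sInter_subset_sInter (Finset.coe_subset.2 hF)
  rcases hcol with hcol | hcol
  · refine h₁ (HasCube.mono (Q := Q) (N := max N₁ N₂) ⟨_, hsub.mono_set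
      (B := ⋂₀ ((F₁ ∪ F₂ : Finset (Set ℕ)) : Set (Set ℕ)) ∩ a) fun t ht => ⟨hsub.1 t ht, ?_⟩⟩
      (fun q hq => by simp [Q, hq]) (le_max_left _ _)
      (Set.inter_subset_inter_left _ (hsup _ Finset.subset_union_left)))
    have := hcol t ht
    rwa [hite t ht] at this
  · refine h₂ (HasCube.mono (Q := Q) (N := max N₁ N₂) ⟨_, hsub.mono_set
      (B := ⋂₀ ((F₁ ∪ F₂ : Finset (Set ℕ)) : Set (Set ℕ)) ∩ aᶜ) fun t ht => ⟨hsub.1 t ht, ?_⟩⟩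
      (fun q hq => by simp [Q, hq]) (le_max_right _ _)
      (Set.inter_subset_inter_left _ (hsup _ Finset.subset_union_right)))
    have := hcol t ht
    rwa [hite t ht] at this

/-- One step in adjoining a function for a new index `p`: a cube for `insert p Q` can be added. -/
theorem Rich.exists_extension_new_index {W : Set (Set ℕ)} {D : Set J} {G : J → ℕ → ℕ}
    (hR : Rich W D G) (hD : ⊤ ∈ D) (hG : G ⊤ = id) [DecidableEq J] {p : J} (hp : p ∉ D)
    (a : Finset ℕ) (h : ℕ → ℕ) {F : Finset (Set ℕ)} (hF : (F : Set (Set ℕ)) ⊆ W) {Q : Finset J}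
    (hQ : (Q : Set J) ⊆ D) (N : ℕ) :
    ∃ (a' : Finset ℕ) (h' : ℕ → ℕ), a ⊆ a' ∧ (∀ x ∈ a, h' x = h x) ∧
      (∀ x ∈ a', x ∉ a → x ∈ ⋂₀ (F : Set (Set ℕ))) ∧
      (∀ x ∈ a', x ∉ a → ∀ y ∈ a', ∀ q ∈ Q,
        (q ≤ p → h' x = h' y → G q x = G q y) ∧ (p ≤ q → G q x = G q y → h' x = h' y)) ∧
      HasCube (Function.update G p h') (insert p Q) N (⋂₀ (F : Set (Set ℕ)) ∩ a') := by
  classical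
  let Q₁ := insert ⊤ Q
  let Q₂ := insert p Q₁
  let L := N + 1
  have hQ₁ : (Q₁ : Set J) ⊆ D := by
    simpa [Q₁, Set.insert_subset_iff] using ⟨hD, hQ⟩
  have htop : ⊤ ∈ Q₁ := Finset.mem_insert_self _ _
  have htop₂ : ⊤ ∈ Q₂ := Finset.mem_insert_of_mem htop
  have hpQ : p ∉ Q₁ := fun hh => hp (hQ₁ hh)
  -- `L ^ 2` leaves room to code pairs of coordinates; `a.card` pays for avoiding the values of each
  -- `G r` on the old points.
  obtain ⟨c, hc⟩ := hR F hF Q₁ hQ₁ (L ^ 2 + a.card)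
  obtain ⟨σ, hσ, hinj, -, hav⟩ := hc.avoid (N := L ^ 2) (fun r => a.image (G r))
    fun r => Nat.add_le_add_left Finset.card_image_le _
  have hc₁ := hc.subcube hσ hinj
  have hav₁ : ∀ q ∈ Q₁, ∀ t : J → ℕ, (∀ r, t r < L ^ 2) →
      ∀ y ∈ a, G q (c fun r => σ r (t r)) ≠ G q y := by
    intro q hq t ht y hy heq
    refine hav q hq (fun r => σ r (t r)) (fun r => hσ r _ (ht r)) ⟨t q, ht q, rfl⟩ ?_
    exact heq ▸ Finset.mem_image_of_mem _ hy
  set c₁ : (J → ℕ) → ℕ := fun t => c fun r => σ r (t r) with hc₁def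
  -- The new coordinate `p` is hidden in all old coordinates above `p`, so exactly the `G q` with `p
  -- ≤ q` see it.
  let up : (J → ℕ) → J → ℕ := fun t r => if p ≤ r then Nat.pair (t r) (t p) else t r
  have hup : ∀ t : J → ℕ, (∀ r, t r < L) → ∀ r, up t r < L ^ 2 := by
    intro t ht r
    simp only [up]
    split_ifs
    · exact (Nat.pair_lt_max_add_one_sq _ _).trans_le
        (Nat.pow_le_pow_left (max_lt (ht r) (ht p)) 2)
    · exact (ht r).trans_le (Nat.le_self_pow two_ne_zero _)
  let c₂ : (J → ℕ) → ℕ := fun t => c₁ (up t)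
  have hcube : ∀ q ∈ Q₁, ∀ t t' : J → ℕ, (∀ r, t r < L) → (∀ r, t' r < L) →
      (G q (c₂ t) = G q (c₂ t') ↔ ∀ r ∈ Q₂, r ≤ q → t r = t' r) := by
    intro q hq t t' ht ht'
    rw [hc₁.2 q hq _ _ (hup t ht) (hup t' ht')]
    constructor
    · intro hh r hr hrq
      rcases Finset.mem_insert.1 hr with rfl | hr
      · have := hh q hq le_rfl
        simp only [up, if_pos hrq, Nat.pair_eq_pair] at this
        exact this.2
      · have := hh r hr hrq
        by_cases hpr : p ≤ r
        · simp only [up, if_pos hpr, Nat.pair_eq_pair] at this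
          exact this.1
        · simpa only [up, if_neg hpr] using this
    · intro hh r hr hrq
      have h1 := hh r (Finset.mem_insert_of_mem hr) hrq
      by_cases hpr : p ≤ r
      · simp only [up, if_pos hpr, h1, hh p (Finset.mem_insert_self _ _) (hpr.trans hrq)]
      · simpa only [up, if_neg hpr] using h1
  have hL : 0 < L := Nat.succ_pos _
  have heq : ∀ t t' : J → ℕ, (∀ r, t r < L) → (∀ r, t' r < L) →
      (c₂ t = c₂ t' ↔ ∀ r ∈ Q₂, t r = t' r) := by
    intro t t' ht ht'
    simpa [hG] using hcube ⊤ htop t t' ht ht'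
  let T := (box Q₂ L).image c₂
  have hTmem : ∀ t : J → ℕ, (∀ r, t r < L) → c₂ t ∈ T := by
    intro t ht
    refine Finset.mem_image.2 ⟨_, mem_box (Q := Q₂) ht, ?_⟩
    refine (heq _ _ (fun r => lt_of_mem_box hL (mem_box ht) r) ht).2 fun r hr => ?_
    simp [hr]
  have hT : ∀ x ∈ T, ∃ t : J → ℕ, (∀ r, t r < L) ∧ c₂ t = x := by
    intro x hx
    obtain ⟨t, ht, rfl⟩ := Finset.mem_image.1 hx
    exact ⟨t, lt_of_mem_box hL ht, rfl⟩
  have hne : ∀ q ∈ Q₁, ∀ x ∈ T, ∀ y ∈ a, G q x ≠ G q y := by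
    intro q hq x hx y hy
    obtain ⟨t, ht, rfl⟩ := hT x hx
    exact hav₁ q hq _ (hup t ht) y hy
  have hTa : ∀ x ∈ T, x ∉ a := fun x hx hxa => hne ⊤ htop x hx x hxa rfl
  let low : (J → ℕ) → J → ℕ := fun t r => if r ∈ Q₂ ∧ r ≤ p then t r else 0
  have hlow : ∀ t t', low t = low t' ↔ ∀ r ∈ Q₂, r ≤ p → t r = t' r := by
    intro t t'
    constructor
    · intro hh r hr hrp
      simpa [low, hr, hrp] using congrFun hh r
    · intro hh
      funext r
      by_cases hr : r ∈ Q₂ ∧ r ≤ p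
      · simp [low, hr, hh r hr.1 hr.2]
      · simp [low, hr]
  obtain ⟨code, hcode⟩ := Set.countable_iff_exists_injOn.1
    ((box Q₂ L).image low).countable_toSet
  have hlowmem : ∀ t : J → ℕ, (∀ r, t r < L) → low t ∈ (box Q₂ L).image low := by
    intro t ht
    refine Finset.mem_image.2 ⟨_, mem_box (Q := Q₂) ht, (hlow _ _).2 fun r hr _ => ?_⟩
    simp [hr]
  choose! dec hdec hdec' using hT
  -- The shift by `b` keeps values at new points apart from those at old points; a new point is
  -- coded by its coordinates below `p`.
  let b := a.sup h + 1
  let h' : ℕ → ℕ := fun x => if x ∈ a then h x else b + code (low (dec x))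
  have hh'a : ∀ x ∈ a, h' x = h x := fun x hx => if_pos hx
  have hh'T : ∀ t : J → ℕ, (∀ r, t r < L) → h' (c₂ t) = b + code (low t) := by
    intro t ht
    have hm := hTmem t ht
    have h1 : low (dec (c₂ t)) = low t := (hlow _ _).2 fun r hr _ =>
      (heq _ _ (hdec _ hm) ht).1 (hdec' _ hm) r hr
    simp only [h', if_neg (hTa _ hm), h1]
  have hh'eq : ∀ t t' : J → ℕ, (∀ r, t r < L) → (∀ r, t' r < L) →
      (h' (c₂ t) = h' (c₂ t') ↔ ∀ r ∈ Q₂, r ≤ p → t r = t' r) := by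
    intro t t' ht ht'
    rw [hh'T t ht, hh'T t' ht', Nat.add_left_cancel_iff,
      hcode.eq_iff (Finset.mem_coe.2 (hlowmem t ht)) (Finset.mem_coe.2 (hlowmem t' ht')), hlow]
  refine ⟨a ∪ T, h', Finset.subset_union_left, hh'a, ?_, ?_, ?_⟩
  · intro x hx hxa
    have hxT := (Finset.mem_union.1 hx).resolve_left hxa
    rw [← hdec' x hxT]
    exact hc₁.1 _ (hup _ (hdec x hxT))
  · intro x hx hxa y hy q hq
    have hxT := (Finset.mem_union.1 hx).resolve_left hxa
    have hq₁ : q ∈ Q₁ := Finset.mem_insert_of_mem hq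
    rcases Finset.mem_union.1 hy with hya | hyT
    · refine ⟨fun _ hxy => ?_, fun _ hxy => (hne q hq₁ x hxT y hya hxy).elim⟩
      rw [hh'a y hya, ← hdec' x hxT, hh'T _ (hdec x hxT)] at hxy
      have := Finset.le_sup (f := h) hya
      omega
    · rw [← hdec' x hxT, ← hdec' y hyT, hcube q hq₁ _ _ (hdec x hxT) (hdec y hyT),
        hh'eq _ _ (hdec x hxT) (hdec y hyT)]
      exact ⟨fun hqp hh r hr hrq => hh r hr (hrq.trans hqp),
        fun hpq hh r hr hrp => hh r hr (hrp.trans hpq)⟩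
  · have : HasCube (Function.update G p h') Q₂ L (⋂₀ (F : Set (Set ℕ)) ∩ ↑(a ∪ T)) := by
      refine ⟨c₂, fun t ht => ⟨hc₁.1 _ (hup t ht), ?_⟩, fun q hq t t' ht ht' => ?_⟩
      · exact Finset.mem_coe.2 (Finset.mem_union_right _ (hTmem t ht))
      · rcases Finset.mem_insert.1 hq with rfl | hq'
        · rw [Function.update_self]
          exact hh'eq t t' ht ht'
        · rw [Function.update_of_ne (fun hh : q = p => hpQ (hh ▸ hq'))]
          exact hcube q hq' t t' ht ht'
    exact this.mono (Finset.insert_subset_insert _ (Finset.subset_insert _ _)) (Nat.le_succ _)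
      subset_rfl

/-- One step in diagonalizing against `ψ`; `b` is the set of values promised to be omitted by
`G p`. -/
theorem Rich.exists_extension_diagonal {W : Set (Set ℕ)} {D : Set J} {G : J → ℕ → ℕ}
    (hR : Rich W D G) (hD : ⊤ ∈ D) (hG : G ⊤ = id) {p q : J} (hp : p ∈ D) (hq : q ∈ D)
    (hpq : ¬ p ≤ q) {ψ : Finset ℕ → Set ℕ} (hψ : Monotone ψ)
    (hψW : ∀ s k, k ∉ ψ s → ∃ B ∈ W, ∀ t : Finset ℕ, (t : Set ℕ) ⊆ G q '' B → k ∉ ψ (s ∪ t))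
    {a b : Finset ℕ} (hab : ∀ x ∈ a, G p x ∉ b)
    (hψab : ∀ s : Finset ℕ, (s : Set ℕ) ⊆ G q '' a → (ψ s).Nonempty → ∃ k ∈ ψ s, k ∈ b)
    {F : Finset (Set ℕ)} (hF : (F : Set (Set ℕ)) ⊆ W) {Q : Finset J}
    (hQ : (Q : Set J) ⊆ D) (N : ℕ) :
    ∃ a' b' : Finset ℕ, (∀ x ∈ a', G p x ∉ b') ∧
      (∀ s : Finset ℕ, (s : Set ℕ) ⊆ G q '' a' → (ψ s).Nonempty → ∃ k ∈ ψ s, k ∈ b') ∧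
      a ⊆ a' ∧ b ⊆ b' ∧ (∀ x ∈ a', x ∉ a → x ∈ ⋂₀ (F : Set (Set ℕ))) ∧
      HasCube G Q N (⋂₀ (F : Set (Set ℕ)) ∩ a') := by
  classical
  let Q₁ := insert p (insert q (insert ⊤ Q))
  have hQ₁ : (Q₁ : Set J) ⊆ D := by
    simpa [Q₁, Set.insert_subset_iff] using ⟨hp, hq, hD, hQ⟩
  have hpQ : p ∈ Q₁ := by simp [Q₁]
  have hqQ : q ∈ Q₁ := by simp [Q₁]
  have htop : ⊤ ∈ Q₁ := by simp [Q₁]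
  let L := N + 1
  have hL : 0 < L := Nat.succ_pos _
  choose! B hBW hB using hψW
  let P := ((a.image (G q)).powerset ×ˢ a.image (G p)).filter fun u => u.2 ∉ ψ u.1
  -- If `k ∈ G p '' a` is not in `ψ s₁` for an old `s₁`, drawing new points from `B s₁ k` ensures
  -- that they never bring `k` in.
  let F' := F ∪ P.image fun u => B u.1 u.2
  have hF' : (F' : Set (Set ℕ)) ⊆ W := by
    intro A hA
    rcases Finset.mem_union.1 (Finset.mem_coe.1 hA) with hA | hA
    · exact hF hA
    · obtain ⟨u, hu, rfl⟩ := Finset.mem_image.1 hA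
      exact hBW _ _ (Finset.mem_filter.1 hu).2
  obtain ⟨c, hc⟩ := hR F' hF' Q₁ hQ₁ (L + (b.card + 2 ^ (a.card + (box Q₁ L).card)))
  set M := L + (b.card + 2 ^ (a.card + (box Q₁ L).card)) with hMdef
  -- All values of `G q` that can occur, however the coordinate `p` is thinned. The bound on the
  -- size of `H` does not involve `M`, so `M` could be chosen large enough beforehand.
  let H := a.image (G q) ∪ (box Q₁ L).image fun t => G q (c (Function.update t p 0))
  have hHcard : H.card ≤ a.card + (box Q₁ L).card :=
    (Finset.card_union_le _ _).trans (add_le_add Finset.card_image_le Finset.card_image_le)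
  have hj : ∀ s : Finset ℕ, ∃ k, (∃ k ∈ ψ s, k ∉ a.image (G p)) → k ∈ ψ s ∧ k ∉ a.image (G p) := by
    intro s
    by_cases h : ∃ k ∈ ψ s, k ∉ a.image (G p)
    · obtain ⟨k, hk⟩ := h
      exact ⟨k, fun _ => hk⟩
    · exact ⟨0, fun h' => (h h').elim⟩
  choose j hj using hj
  -- For each possible `s`, promise to omit one point of `ψ s` not yet used by `G p`. Thinning only
  -- the coordinate `p` keeps the promises.
  let Z := b ∪ (H.powerset.filter fun s => ∃ k ∈ ψ s, k ∉ a.image (G p)).image j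
  have hZcard : Z.card ≤ b.card + 2 ^ (a.card + (box Q₁ L).card) := by
    refine (Finset.card_union_le _ _).trans (add_le_add le_rfl ?_)
    refine Finset.card_image_le.trans ((Finset.card_filter_le _ _).trans ?_)
    rw [Finset.card_powerset]
    exact Nat.pow_le_pow_right two_pos hHcard
  obtain ⟨σ, hσ, hinj, hid, hav⟩ := hc.avoid (N := L) (fun r => if r = p then Z else ∅) (by
    intro r
    split_ifs
    · exact Nat.add_le_add_left hZcard _
    · simp [hMdef])
  have hc₁ := hc.subcube hσ hinj
  set c₁ : (J → ℕ) → ℕ := fun t => c fun r => σ r (t r) with hc₁def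
  let T := (box Q₁ L).image c₁
  have hTmem : ∀ t : J → ℕ, (∀ r, t r < L) → c₁ t ∈ T := fun t ht =>
    hc₁.mem_image_box hG htop ht
  have hTF : ∀ x ∈ T, x ∈ ⋂₀ (F' : Set (Set ℕ)) := by
    intro x hx
    obtain ⟨t, ht, rfl⟩ := Finset.mem_image.1 hx
    exact hc₁.1 t (lt_of_mem_box hL ht)
  have hFF' : ⋂₀ (F' : Set (Set ℕ)) ⊆ ⋂₀ (F : Set (Set ℕ)) :=
    Set.sInter_subset_sInter (Finset.coe_subset.2 Finset.subset_union_left)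
  have hTH : ∀ x ∈ T, G q x ∈ H := by
    intro x hx
    obtain ⟨t, ht, rfl⟩ := Finset.mem_image.1 hx
    refine Finset.mem_union_right _ (Finset.mem_image.2 ⟨t, ht, ?_⟩)
    have htL := lt_of_mem_box hL ht
    refine (hc.2 q hqQ _ _ ?_ fun r => hσ r _ (htL r)).2 ?_
    · intro r
      by_cases hr : r = p
      · subst hr; simp [hMdef, hL]
      · rw [Function.update_of_ne hr]; exact (htL r).trans_le (Nat.le_add_right _ _)
    · intro r _ hrq
      have hr : r ≠ p := fun h => hpq (h ▸ hrq)
      rw [Function.update_of_ne hr, hid r (by simp [hr])]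
  refine ⟨a ∪ T, Z, ?_, ?_, Finset.subset_union_left, Finset.subset_union_left, ?_, ?_⟩
  · intro x hx
    rcases Finset.mem_union.1 hx with hx | hx
    · intro hZ
      rcases Finset.mem_union.1 hZ with hZ | hZ
      · exact hab x hx hZ
      · obtain ⟨s, hs, hsx⟩ := Finset.mem_image.1 hZ
        exact (hj s (Finset.mem_filter.1 hs).2).2 (hsx ▸ Finset.mem_image_of_mem _ hx)
    · obtain ⟨t, ht, rfl⟩ := Finset.mem_image.1 hx
      have htL := lt_of_mem_box hL ht
      have := hav p hpQ (fun r => σ r (t r)) (fun r => hσ r _ (htL r)) ⟨t p, htL p, rfl⟩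
      simpa using this
  · intro s hs hne
    have hsH : s ∈ H.powerset := by
      refine Finset.mem_powerset.2 fun y hy => ?_
      obtain ⟨x, hx, rfl⟩ := hs hy
      rcases Finset.mem_union.1 (Finset.mem_coe.1 hx) with hx | hx
      · exact Finset.mem_union_left _ (Finset.mem_image_of_mem _ hx)
      · exact hTH x hx
    let s₁ := s.filter fun y => y ∈ a.image (G q)
    let s₂ := s.filter fun y => y ∉ a.image (G q)
    have hs₁₂ : s₁ ∪ s₂ = s := Finset.filter_union_filter_not_eq _ _
    have hs₁ : s₁ ⊆ a.image (G q) := fun y hy => (Finset.mem_filter.1 hy).2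
    -- If `ψ s₁` is nonempty, an old promise serves by monotonicity. Otherwise `F'` keeps `ψ s`
    -- disjoint from `G p '' a`, so `j s` is available.
    rcases (ψ s₁).eq_empty_or_nonempty with h0 | h0
    · obtain ⟨k, hk⟩ := hne
      have hka : k ∉ a.image (G p) := by
        intro hka
        have hk₁ : k ∉ ψ s₁ := by simp [h0]
        refine hB s₁ k hk₁ s₂ ?_ (hs₁₂ ▸ hk)
        intro y hy
        obtain ⟨hys, hya⟩ := Finset.mem_filter.1 (Finset.mem_coe.1 hy)
        obtain ⟨x, hx, rfl⟩ := hs hys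
        have hxT : x ∈ T := (Finset.mem_union.1 (Finset.mem_coe.1 hx)).resolve_left
          fun hxa => hya (Finset.mem_image_of_mem _ hxa)
        refine ⟨x, hTF x hxT _ ?_, rfl⟩
        refine Finset.mem_coe.2 (Finset.mem_union_right _ (Finset.mem_image.2 ⟨(s₁, k), ?_, rfl⟩))
        exact Finset.mem_filter.2 ⟨Finset.mem_product.2 ⟨Finset.mem_powerset.2 hs₁, hka⟩, hk₁⟩
      have hex : ∃ k ∈ ψ s, k ∉ a.image (G p) := ⟨k, hk, hka⟩
      exact ⟨j s, (hj s hex).1, Finset.mem_union_right _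
        (Finset.mem_image_of_mem _ (Finset.mem_filter.2 ⟨hsH, hex⟩))⟩
    · obtain ⟨k, hk, hkb⟩ := hψab s₁ (by
        intro y hy
        simpa using hs₁ hy) h0
      exact ⟨k, hψ (Finset.filter_subset _ _) hk, Finset.mem_union_left _ hkb⟩
  · intro x hx hxa
    exact hFF' (hTF x ((Finset.mem_union.1 hx).resolve_left hxa))
  · refine HasCube.mono (Q := Q₁) (N := L) ⟨c₁, hc₁.mono_set
      (B := ⋂₀ (F : Set (Set ℕ)) ∩ ↑(a ∪ T)) fun t ht => ⟨hFF' (hc₁.1 t ht), ?_⟩⟩ ?_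
      (Nat.le_succ _) subset_rfl
    · exact Finset.mem_coe.2 (Finset.mem_union_right _ (hTmem t ht))
    · intro r hr
      simp [Q₁, hr]

end Rich

end PPoints

/-! ### Generic projections and generic diagonalizing sets. -/

namespace PPoints

open Cardinal

/-- Forcing with promises given by a finite subset of `W` and a finite subset of `D`. -/
theorem MASigmaCentered.exists_generic_pair (hMA : MASigmaCentered) {σ α β : Type} [Countable σ]
    [Nonempty σ] {W : Set α} {D : Set β} (hW : #W < continuum) (hD : #D < continuum)
    (R : Finset α → Finset β → σ → σ → Prop)
    (hrefl : ∀ F Q s, R F Q s s) (htrans : ∀ F Q s t u, R F Q s t → R F Q t u → R F Q s u)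
    (hmono : ∀ F F' Q Q' s t, F ⊆ F' → Q ⊆ Q' → R F' Q' s t → R F Q s t)
    (E : Finset α → Finset β → ℕ → Set σ)
    (hEmono : ∀ F F' Q Q' N, F ⊆ F' → Q ⊆ Q' → E F' Q' N ⊆ E F Q N)
    (hE : ∀ F : Finset α, (F : Set α) ⊆ W → ∀ Q : Finset β, (Q : Set β) ⊆ D → ∀ N s,
      ∃ t, R F Q s t ∧ t ∈ E F Q N) :
    ∃ G : Set (σ × Finset α × Finset β),
      (∀ c ∈ G, ∀ d ∈ G, ∃ e ∈ G, R c.2.1 c.2.2 c.1 e.1 ∧ R d.2.1 d.2.2 d.1 e.1) ∧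
      ∀ F : Finset α, (F : Set α) ⊆ W → ∀ Q : Finset β, (Q : Set β) ⊆ D → ∀ N,
        ∃ c ∈ G, F ⊆ c.2.1 ∧ Q ⊆ c.2.2 ∧ c.1 ∈ E F Q N := by
  classical
  let f : Finset (W ⊕ D) → Finset α := fun X => X.toLeft.image Subtype.val
  let g : Finset (W ⊕ D) → Finset β := fun X => X.toRight.image Subtype.val
  have hf : Monotone f := fun X Y h => Finset.image_subset_image (Finset.toLeft_subset_toLeft h)
  have hg : Monotone g := fun X Y h => Finset.image_subset_image (Finset.toRight_subset_toRight h)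
  have hfW : ∀ X, (f X : Set α) ⊆ W := by
    intro X x hx
    obtain ⟨y, -, rfl⟩ := Finset.mem_image.1 (Finset.mem_coe.1 hx)
    exact y.2
  have hgD : ∀ X, (g X : Set β) ⊆ D := by
    intro X x hx
    obtain ⟨y, -, rfl⟩ := Finset.mem_image.1 (Finset.mem_coe.1 hx)
    exact y.2
  have hcard : #(W ⊕ D) < continuum := by
    rw [mk_sum, lift_id, lift_id]
    exact add_lt_of_lt aleph0_le_continuum hW hD
  obtain ⟨G, hG, hGE⟩ := hMA.exists_generic (σ := σ) hcard (fun X => R (f X) (g X))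
    (fun X => hrefl _ _) (fun X => htrans _ _) (fun X Y s t h => hmono _ _ _ _ s t (hf h) (hg h))
    (fun X => E (f X) (g X)) (fun X Y N h => hEmono _ _ _ _ N (hf h) (hg h))
    (fun X N s => hE _ (hfW X) _ (hgD X) N s)
  refine ⟨(fun c => (c.state, f c.side, g c.side)) '' G, ?_, fun F hF Q hQ N => ?_⟩
  · rintro _ ⟨c, hc, rfl⟩ _ ⟨d, hd, rfl⟩
    obtain ⟨e, he, h⟩ := hG c hc d hd
    exact ⟨_, ⟨e, he, rfl⟩, h⟩
  · let X : Finset (W ⊕ D) := (F.subtype (· ∈ W)).disjSum (Q.subtype (· ∈ D))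
    have hfX : f X = F := by
      ext x
      simpa [f, X] using fun h => hF h
    have hgX : g X = Q := by
      ext x
      simpa [g, X] using fun h => hQ h
    obtain ⟨c, hc, hXc, hcE⟩ := hGE X N
    refine ⟨_, ⟨c, hc, rfl⟩, ?_, ?_, ?_⟩
    · exact hfX ▸ hf hXc
    · exact hgX ▸ hg hXc
    · simpa only [hfX, hgX] using hcE

section Tasks

variable {J : Type} [PartialOrder J] [OrderTop J]

/-- A function for a new index can be adjoined. -/
theorem Rich.exists_new_index (hMA : MASigmaCentered) {W : Set (Set ℕ)} {D : Set J}
    {G : J → ℕ → ℕ} (hR : Rich W D G) (hW : #W < continuum) (hDc : #D < continuum) (hD : ⊤ ∈ D)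
    (hG : G ⊤ = id) [DecidableEq J] {p : J} (hp : p ∉ D) :
    ∃ (h : ℕ → ℕ) (A : Set ℕ), Rich (insert A W) (insert p D) (Function.update G p h) ∧
      ∀ q ∈ D, ∃ E : Set ℕ, E.Finite ∧ ∀ x ∈ A \ E, ∀ y ∈ A \ E,
        (q ≤ p → h x = h y → G q x = G q y) ∧ (p ≤ q → G q x = G q y → h x = h y) := by
  classical
  -- Finite support keeps the working parts countable. A promise `q` binds every pair with at least
  -- one new point, so its exceptional set is finite.
  obtain ⟨C, hC, hCE⟩ := hMA.exists_generic_pair (σ := Finset ℕ × (ℕ →₀ ℕ)) hW hDc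
    (fun F Q u v => u.1 ⊆ v.1 ∧ (∀ x ∈ u.1, v.2 x = u.2 x) ∧
      (∀ x ∈ v.1, x ∉ u.1 → x ∈ ⋂₀ (F : Set (Set ℕ))) ∧
      ∀ x ∈ v.1, x ∉ u.1 → ∀ y ∈ v.1, ∀ q ∈ Q,
        (q ≤ p → v.2 x = v.2 y → G q x = G q y) ∧ (p ≤ q → G q x = G q y → v.2 x = v.2 y))
    (fun F Q s => ⟨subset_rfl, fun _ _ => rfl, fun _ h h' => (h' h).elim,
      fun _ h h' => (h' h).elim⟩)
    (by
      rintro F Q s t u ⟨h1, h2, h3, h4⟩ ⟨k1, k2, k3, k4⟩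
      refine ⟨h1.trans k1, fun x hx => (k2 x (h1 hx)).trans (h2 x hx), fun x hx hxs => ?_,
        fun x hx hxs y hy q hq => ?_⟩
      · by_cases hxt : x ∈ t.1
        · exact h3 x hxt hxs
        · exact k3 x hx hxt
      · by_cases hxt : x ∈ t.1
        · by_cases hyt : y ∈ t.1
          · rw [k2 x hxt, k2 y hyt]
            exact h4 x hxt hxs y hyt q hq
          · have := k4 y hy hyt x hx q hq
            exact ⟨fun h h' => (this.1 h h'.symm).symm, fun h h' => (this.2 h h'.symm).symm⟩
        · exact k4 x hx hxt y hy q hq)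
    (by
      rintro F F' Q Q' s t hF hQ ⟨h1, h2, h3, h4⟩
      exact ⟨h1, h2, fun x hx hxs => Set.sInter_subset_sInter (Finset.coe_subset.2 hF) (h3 x hx hxs),
        fun x hx hxs y hy q hq => h4 x hx hxs y hy q (hQ hq)⟩)
    (fun F Q N => {u | HasCube (Function.update G p u.2) (insert p Q) N
      (⋂₀ (F : Set (Set ℕ)) ∩ u.1)})
    (fun F F' Q Q' N hF hQ u hu => HasCube.mono hu (Finset.insert_subset_insert _ hQ) le_rfl
      (Set.inter_subset_inter_left _ (Set.sInter_subset_sInter (Finset.coe_subset.2 hF))))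
    (by
      rintro F hF Q hQ N ⟨a, h⟩
      obtain ⟨a', h', h1, h2, h3, h4, h5⟩ := hR.exists_extension_new_index hD hG hp a h hF hQ N
      let k : ℕ →₀ ℕ := Finsupp.onFinset a' (fun x => if x ∈ a' then h' x else 0) (by
        intro x hx
        by_contra hcon
        simp [hcon] at hx)
      have hk : ∀ x ∈ a', k x = h' x := fun x hx => by simp [k, hx]
      refine ⟨(a', k), ⟨h1, fun x hx => (hk x (h1 hx)).trans (h2 x hx), h3, ?_⟩, ?_⟩
      · intro x hx hxa y hy q hq
        dsimp only
        rw [hk x hx, hk y hy]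
        exact h4 x hx hxa y hy q hq
      · refine HasCube.congr h5 fun q _ x hx => ?_
        by_cases hqp : q = p
        · subst hqp
          simpa using (hk x hx.2).symm
        · simp [hqp])
  let A : Set ℕ := ⋃ c ∈ C, (c.1.1 : Set ℕ)
  have hval : ∀ x, ∃ v, ∀ c ∈ C, x ∈ c.1.1 → c.1.2 x = v := by
    intro x
    by_cases hx : ∃ c ∈ C, x ∈ c.1.1
    · obtain ⟨c, hc, hxc⟩ := hx
      refine ⟨c.1.2 x, fun d hd hxd => ?_⟩
      obtain ⟨e, -, h1, h2⟩ := hC c hc d hd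
      rw [← h1.2.1 x hxc, h2.2.1 x hxd]
    · exact ⟨0, fun c hc hxc => (hx ⟨c, hc, hxc⟩).elim⟩
  choose h hh using hval
  have hsub : ∀ c ∈ C, (c.1.1 : Set ℕ) ⊆ A := fun c hc =>
    Set.subset_biUnion_of_mem (u := fun c => (c.1.1 : Set ℕ)) hc
  refine ⟨h, A, rich_insert fun F hF Q hQ N => ?_, fun q hq => ?_⟩
  · obtain ⟨c, hc, -, -, hcE⟩ := hCE F hF (Q.erase p) (by
      intro q hq
      simp only [Finset.coe_erase, Set.mem_sdiff, Set.mem_singleton_iff] at hq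
      exact (hQ hq.1).resolve_left hq.2) N
    refine HasCube.mono (HasCube.congr hcE (G' := Function.update G p h) fun q _ x hx => ?_)
      (Finset.insert_erase_subset p Q) le_rfl (Set.inter_subset_inter_right _ (hsub c hc))
    by_cases hqp : q = p
    · subst hqp
      simpa using hh x c hc hx.2
    · simp [hqp]
  · obtain ⟨c, hc, -, hqc, -⟩ := hCE ∅ (by simp) {q} (by simpa using hq) 0
    have hq_side : q ∈ c.2.2 := hqc (Finset.mem_singleton_self q)
    refine ⟨c.1.1, c.1.1.finite_toSet, ?_⟩
    rintro x ⟨hxA, hxc⟩ y ⟨hyA, hyc⟩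
    obtain ⟨d, hd, hxd⟩ := Set.mem_iUnion₂.1 hxA
    obtain ⟨e, he, hye⟩ := Set.mem_iUnion₂.1 hyA
    obtain ⟨d', hd', hcd, hdd⟩ := hC c hc d hd
    obtain ⟨e', he', hce, hee⟩ := hC c hc e he
    obtain ⟨u, hu, hdu, heu⟩ := hC d' hd' e' he'
    obtain ⟨v, hv, hcv, huv⟩ := hC c hc u hu
    have hxv : x ∈ v.1.1 := huv.1 (hdu.1 (hdd.1 hxd))
    have hyv : y ∈ v.1.1 := huv.1 (heu.1 (hee.1 hye))
    rw [← hh x v hv hxv, ← hh y v hv hyv]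
    exact hcv.2.2.2 x hxv hxc y hyv q hq_side

/-- A set can be adjoined which is almost contained in all members of `W` and diagonalizes against
`ψ` as a Tukey map from the image ultrafilter at `q` to the one at `p`. -/
theorem Rich.exists_diagonal (hMA : MASigmaCentered) {W : Set (Set ℕ)} {D : Set J}
    {G : J → ℕ → ℕ} (hR : Rich W D G) (hW : #W < continuum) (hDc : #D < continuum) (hD : ⊤ ∈ D)
    (hG : G ⊤ = id) {p q : J} (hp : p ∈ D) (hq : q ∈ D) (hpq : ¬ p ≤ q) {ψ : Finset ℕ → Set ℕ}
    (hψ : Monotone ψ) (hψ0 : ψ ∅ = ∅)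
    (hψW : ∀ s k, k ∉ ψ s → ∃ B ∈ W, ∀ t : Finset ℕ, (t : Set ℕ) ⊆ G q '' B → k ∉ ψ (s ∪ t)) :
    ∃ A : Set ℕ, Rich (insert A W) D G ∧ (∀ B ∈ W, (A \ B).Finite) ∧
      ∀ s : Finset ℕ, (s : Set ℕ) ⊆ G q '' A → (ψ s).Nonempty → ∃ k ∈ ψ s, k ∉ G p '' A := by
  classical
  -- A pair approximates `A` and the set of values omitted by `G p '' A`; `ψ ∅ = ∅` makes the empty
  -- pair admissible.
  let σ := {u : Finset ℕ × Finset ℕ // (∀ x ∈ u.1, G p x ∉ u.2) ∧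
    ∀ s : Finset ℕ, (s : Set ℕ) ⊆ G q '' u.1 → (ψ s).Nonempty → ∃ k ∈ ψ s, k ∈ u.2}
  have : Nonempty σ := ⟨⟨(∅, ∅), by simp, fun s hs hne => by
    obtain rfl : s = ∅ := by simpa using hs
    simp [hψ0] at hne⟩⟩
  obtain ⟨C, hC, hCE⟩ := hMA.exists_generic_pair (σ := σ) hW hDc
    (fun F (_ : Finset J) u v => u.1.1 ⊆ v.1.1 ∧ u.1.2 ⊆ v.1.2 ∧
      ∀ x ∈ v.1.1, x ∉ u.1.1 → x ∈ ⋂₀ (F : Set (Set ℕ)))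
    (fun F Q s => ⟨subset_rfl, subset_rfl, fun _ h h' => (h' h).elim⟩)
    (by
      rintro F Q s t u ⟨h1, h2, h3⟩ ⟨k1, k2, k3⟩
      refine ⟨h1.trans k1, h2.trans k2, fun x hx hxs => ?_⟩
      by_cases hxt : x ∈ t.1.1
      · exact h3 x hxt hxs
      · exact k3 x hx hxt)
    (by
      rintro F F' Q Q' s t hF hQ ⟨h1, h2, h3⟩
      exact ⟨h1, h2, fun x hx hxs =>
        Set.sInter_subset_sInter (Finset.coe_subset.2 hF) (h3 x hx hxs)⟩)
    (fun F Q N => {u | HasCube G Q N (⋂₀ (F : Set (Set ℕ)) ∩ u.1.1)})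
    (fun F F' Q Q' N hF hQ u hu => HasCube.mono hu hQ le_rfl
      (Set.inter_subset_inter_left _ (Set.sInter_subset_sInter (Finset.coe_subset.2 hF))))
    (by
      rintro F hF Q hQ N ⟨⟨a, b⟩, h1, h2⟩
      obtain ⟨a', b', k1, k2, k3, k4, k5, k6⟩ :=
        hR.exists_extension_diagonal hD hG hp hq hpq hψ hψW h1 h2 hF hQ N
      exact ⟨⟨(a', b'), k1, k2⟩, ⟨k3, k4, k5⟩, k6⟩)
  let A : Set ℕ := ⋃ c ∈ C, (c.1.1.1 : Set ℕ)
  have hsub : ∀ c ∈ C, (c.1.1.1 : Set ℕ) ⊆ A := fun c hc =>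
    Set.subset_biUnion_of_mem (u := fun c : σ × Finset (Set ℕ) × Finset J => (c.1.1.1 : Set ℕ)) hc
  have hfin : ∀ a : Finset ℕ, (a : Set ℕ) ⊆ A → ∃ c ∈ C, a ⊆ c.1.1.1 := by
    intro a
    induction a using Finset.induction_on with
    | empty =>
      intro _
      obtain ⟨c, hc, -⟩ := hCE ∅ (by simp) ∅ (by simp) 0
      exact ⟨c, hc, by simp⟩
    | insert x a _ ih =>
      intro h
      rw [Finset.coe_insert, Set.insert_subset_iff] at h
      obtain ⟨c, hc, hac⟩ := ih h.2
      obtain ⟨d, hd, hxd⟩ := Set.mem_iUnion₂.1 h.1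
      obtain ⟨e, he, hce, hde⟩ := hC c hc d hd
      exact ⟨e, he, Finset.insert_subset (hde.1 hxd) (hac.trans hce.1)⟩
  refine ⟨A, rich_insert fun F hF Q hQ N => ?_, fun B hB => ?_, fun s hs hne => ?_⟩
  · obtain ⟨c, hc, -, -, hcE⟩ := hCE F hF Q hQ N
    exact HasCube.mono hcE subset_rfl le_rfl (Set.inter_subset_inter_right _ (hsub c hc))
  · obtain ⟨c, hc, hBc, -, -⟩ := hCE {B} (by simpa using hB) ∅ (by simp) 0
    refine c.1.1.1.finite_toSet.subset ?_
    rintro x ⟨hxA, hxB⟩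
    by_contra hxc
    obtain ⟨d, hd, hxd⟩ := Set.mem_iUnion₂.1 hxA
    obtain ⟨e, he, hce, hde⟩ := hC c hc d hd
    exact hxB (hce.2.2 x (hde.1 hxd) hxc B (Finset.mem_coe.2 (hBc (Finset.mem_singleton_self B))))
  · obtain ⟨a, haA, has⟩ := Finset.subset_set_image_iff.1 hs
    obtain ⟨c, hc, hac⟩ := hfin a haA
    obtain ⟨k, hk, hkc⟩ := c.1.2.2 s (by
      rw [← has, Finset.coe_image]
      exact Set.image_mono (Finset.coe_subset.2 hac)) hne
    refine ⟨k, hk, ?_⟩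
    rintro ⟨x, hxA, rfl⟩
    obtain ⟨d, hd, hxd⟩ := Set.mem_iUnion₂.1 hxA
    obtain ⟨e, he, hce, hde⟩ := hC c hc d hd
    exact e.1.2.1 x (hde.1 hxd) (hce.2.1 hkc)

end Tasks

end PPoints

/-! ### The construction as a closed set of facts. -/

namespace PPoints

open Cardinal

section System

variable {J : Type}

/-- Facts to be collected in the construction: `Sum.inl A` puts `A` into the ultrafilter, and
`Sum.inr (p, h)` makes `h` the projection at the index `p`. -/
abbrev Fact (J : Type) : Type := Set ℕ ⊕ (J × (ℕ → ℕ))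

/-- The sets put into the ultrafilter by `S`. -/
def setsOf (S : Set (Fact J)) : Set (Set ℕ) := {A | Sum.inl A ∈ S}

/-- The indices whose projections are determined by `S`. -/
def domOf (S : Set (Fact J)) : Set J := {p | ∃ h, Sum.inr (p, h) ∈ S}

/-- On `A`, up to a finite set, `h` factors through `g`. -/
def FactorsOn (A : Set ℕ) (g h : ℕ → ℕ) : Prop :=
  ∃ E : Set ℕ, E.Finite ∧ ∀ x ∈ A \ E, ∀ y ∈ A \ E, g x = g y → h x = h y

theorem exists_projections (S : Set (Fact J)) :
    ∃ G : J → ℕ → ℕ, ∀ p ∈ domOf S, Sum.inr (p, G p) ∈ S := by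
  classical
  refine ⟨fun p => if h : p ∈ domOf S then h.choose else id, fun p hp => ?_⟩
  simp only [dif_pos hp]
  exact hp.choose_spec

theorem mk_setsOf_le (S : Set (Fact J)) : #(setsOf S) ≤ #S :=
  mk_le_of_injective (f := fun A : setsOf S => (⟨Sum.inl A.1, A.2⟩ : S)) fun A B h => by
    simpa [Subtype.ext_iff] using h

theorem mk_domOf_le (S : Set (Fact J)) : #(domOf S) ≤ #S := by
  obtain ⟨G, hG⟩ := exists_projections S
  refine mk_le_of_injective (f := fun p : domOf S => (⟨Sum.inr (p.1, G p), hG p p.2⟩ : S)) ?_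
  intro p q h
  simp only [Subtype.mk.injEq, Sum.inr.injEq, Prod.mk.injEq] at h
  exact Subtype.ext h.1

theorem setsOf_insert_inl (S : Set (Fact J)) (A : Set ℕ) :
    setsOf (insert (Sum.inl A) S) = insert A (setsOf S) := by
  ext B; simp [setsOf]

theorem domOf_insert_inl (S : Set (Fact J)) (A : Set ℕ) :
    domOf (insert (Sum.inl A) S) = domOf S := by
  ext B; simp [domOf]

/-- Tasks: deciding a set, adjoining an index, diagonalizing against a finitary map. -/
abbrev Task (J : Type) : Type := Set ℕ ⊕ J ⊕ (J × J × (Finset ℕ → Set ℕ))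

theorem mk_task_le (hJ : #J ≤ continuum) : #(Task J) ≤ continuum := by
  have h1 : #(Set ℕ) = continuum := by simp
  have h2 : #(Finset ℕ → Set ℕ) = continuum := by simp
  simp only [Task, mk_sum, mk_prod, lift_id, h1, h2]
  refine add_le_of_le aleph0_le_continuum le_rfl (add_le_of_le aleph0_le_continuum hJ ?_)
  exact mul_le_of_le aleph0_le_continuum hJ (mul_le_of_le aleph0_le_continuum hJ le_rfl)

variable [PartialOrder J]

/-- The clauses have finite character, so goodness passes to unions of chains. In `rich` the choice
of `G` off `domOf S` is immaterial. -/
structure IsGood (S : Set (Fact J)) : Prop where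
  functional : ∀ p h h', Sum.inr (p, h) ∈ S → Sum.inr (p, h') ∈ S → h = h'
  rich : ∀ G : J → ℕ → ℕ, (∀ p ∈ domOf S, Sum.inr (p, G p) ∈ S) → Rich (setsOf S) (domOf S) G
  factor : ∀ p q h g, Sum.inr (p, h) ∈ S → Sum.inr (q, g) ∈ S → p < q →
    ∃ A, Sum.inl A ∈ S ∧ FactorsOn A g h

theorem IsGood.sUnion {C : Set (Set (Fact J))} (hne : C.Nonempty) (hC : IsChain (· ⊆ ·) C)
    (hg : ∀ S ∈ C, IsGood S) : IsGood (⋃₀ C) := by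
  classical
  have hfin : ∀ X : Finset (Fact J), (X : Set (Fact J)) ⊆ ⋃₀ C →
      ∃ S ∈ C, (X : Set (Fact J)) ⊆ S := by
    intro X hX
    rw [Set.sUnion_eq_biUnion] at hX
    exact DirectedOn.exists_mem_subset_of_finset_subset_biUnion hne hC.directedOn hX
  have hfun : ∀ p h h', Sum.inr (p, h) ∈ ⋃₀ C → Sum.inr (p, h') ∈ ⋃₀ C → h = h' := by
    intro p h h' h1 h2
    obtain ⟨S, hS, hX⟩ := hfin {Sum.inr (p, h), Sum.inr (p, h')} (by
      simp [Set.insert_subset_iff, h1, h2, -Set.mem_sUnion])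
    exact (hg S hS).functional p h h' (hX (by simp)) (hX (by simp))
  refine ⟨hfun, fun G hG F hF Q hQ N => ?_, fun p q h g h1 h2 hpq => ?_⟩
  · obtain ⟨S, hS, hX⟩ := hfin (F.image Sum.inl ∪ Q.image fun q => Sum.inr (q, G q)) (by
      intro x hx
      rcases Finset.mem_union.1 (Finset.mem_coe.1 hx) with hx | hx
      · obtain ⟨A, hA, rfl⟩ := Finset.mem_image.1 hx
        exact hF hA
      · obtain ⟨q, hq, rfl⟩ := Finset.mem_image.1 hx
        exact hG q (hQ hq))
    refine (hg S hS).rich G ?_ F ?_ Q ?_ N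
    · rintro p ⟨h, hp⟩
      have hpC : Sum.inr (p, h) ∈ ⋃₀ C := ⟨S, hS, hp⟩
      rwa [hfun p (G p) h (hG p ⟨h, hpC⟩) hpC]
    · intro A hA
      exact hX (Finset.mem_coe.2 (Finset.mem_union_left _ (Finset.mem_image_of_mem _ hA)))
    · intro q hq
      exact ⟨G q, hX (Finset.mem_coe.2 (Finset.mem_union_right _ (Finset.mem_image_of_mem
        (fun q => Sum.inr (q, G q)) (Finset.mem_coe.1 hq))))⟩
  · obtain ⟨S, hS, hX⟩ := hfin {Sum.inr (p, h), Sum.inr (q, g)} (by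
      simp [Set.insert_subset_iff, h1, h2, -Set.mem_sUnion])
    obtain ⟨A, hA, h⟩ := (hg S hS).factor p q h g (hX (by simp)) (hX (by simp)) hpq
    exact ⟨A, ⟨S, hS, hA⟩, h⟩

theorem IsGood.insert_inl {S : Set (Fact J)} (hS : IsGood S) {G : J → ℕ → ℕ}
    (hG : ∀ p ∈ domOf S, Sum.inr (p, G p) ∈ S) {A : Set ℕ}
    (hA : Rich (insert A (setsOf S)) (domOf S) G) : IsGood (insert (Sum.inl A) S) := by
  refine ⟨fun p h h' => by simpa using hS.functional p h h', fun G' hG' => ?_,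
    fun p q h g h1 h2 hpq => ?_⟩
  · rw [setsOf_insert_inl, domOf_insert_inl] at *
    intro F hF Q hQ N
    refine (hA F hF Q hQ N).congr fun q hq x _ => ?_
    have := hG' q (hQ hq)
    rw [hS.functional q _ _ (hG q (hQ hq)) (by simpa using this)]
  · obtain ⟨B, hB, h⟩ := hS.factor p q h g (by simpa using h1) (by simpa using h2) hpq
    exact ⟨B, Or.inr hB, h⟩

variable [OrderTop J]

/-- The second set of facts fulfils the given task over the first. -/
def Fulfils : Task J → Set (Fact J) → Set (Fact J) → Prop
  | Sum.inl a, _, S' => Sum.inl a ∈ S' ∨ Sum.inl aᶜ ∈ S'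
  | Sum.inr (Sum.inl p), _, S' => p ∈ domOf S'
  | Sum.inr (Sum.inr (p, q, ψ)), S, S' => ∀ h g, Sum.inr (p, h) ∈ S → Sum.inr (q, g) ∈ S →
      ¬ p ≤ q → Monotone ψ → ψ ∅ = ∅ →
      (∀ s k, k ∉ ψ s → ∃ B ∈ setsOf S, ∀ t : Finset ℕ, (t : Set ℕ) ⊆ g '' B → k ∉ ψ (s ∪ t)) →
      ∃ A, Sum.inl A ∈ S' ∧ (∀ B ∈ setsOf S, (A \ B).Finite) ∧
        ∀ s : Finset ℕ, (s : Set ℕ) ⊆ g '' A → (ψ s).Nonempty → ∃ k ∈ ψ s, k ∉ h '' A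

/-- The successor step of the recursion; `#S < continuum` bounds the number of promises, so Martin's
axiom applies. -/
theorem IsGood.exists_fulfils (hMA : MASigmaCentered) (τ : Task J) {S : Set (Fact J)}
    (hS : IsGood S) (htop : Sum.inr (⊤, id) ∈ S) (hc : #S < continuum) :
    ∃ S', S ⊆ S' ∧ IsGood S' ∧ (S' \ S).Countable ∧ Fulfils τ S S' := by
  classical
  obtain ⟨G, hG⟩ := exists_projections S
  have hGeq : ∀ p h, Sum.inr (p, h) ∈ S → G p = h := fun p h hp =>
    hS.functional p _ _ (hG p ⟨h, hp⟩) hp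
  have hD : ⊤ ∈ domOf S := ⟨id, htop⟩
  have hGtop : G ⊤ = id := hGeq _ _ htop
  have hR := hS.rich G hG
  have hW := (mk_setsOf_le S).trans_lt hc
  have hDc := (mk_domOf_le S).trans_lt hc
  have hcnt : ∀ x, (insert x S \ S).Countable := fun x =>
    (Set.countable_singleton x).mono (by rintro y ⟨rfl | h, h'⟩ <;> simp_all)
  rcases τ with a | p | ⟨p, q, ψ⟩
  · rcases hR.insert_or_insert_compl hD hGtop a with h | h
    · exact ⟨_, Set.subset_insert _ _, hS.insert_inl hG h, hcnt _, Or.inl (Or.inl rfl)⟩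
    · exact ⟨_, Set.subset_insert _ _, hS.insert_inl hG h, hcnt _, Or.inr (Or.inl rfl)⟩
  · by_cases hp : p ∈ domOf S
    · exact ⟨S, subset_rfl, hS, by simp, hp⟩
    obtain ⟨h, A, hRA, hfac⟩ := hR.exists_new_index hMA hW hDc hD hGtop hp
    have hpS : ∀ h', Sum.inr (p, h') ∉ S := fun h' hh => hp ⟨h', hh⟩
    let S' : Set (Fact J) := insert (Sum.inl A) (insert (Sum.inr (p, h)) S)
    have hmem : ∀ q g, Sum.inr (q, g) ∈ S' ↔ (q = p ∧ g = h) ∨ Sum.inr (q, g) ∈ S := by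
      intro q g; simp [S']
    have hSS' : S ⊆ S' := (Set.subset_insert _ _).trans (Set.subset_insert _ _)
    have hsets : setsOf S' = insert A (setsOf S) := by
      ext B; simp [setsOf, S']
    have hdom : domOf S' = insert p (domOf S) := by
      ext q
      simp only [domOf, hmem, Set.mem_ofPred_eq, Set.mem_insert_iff]
      constructor
      · rintro ⟨g, ⟨rfl, -⟩ | hg⟩
        exacts [Or.inl rfl, Or.inr ⟨g, hg⟩]
      · rintro (rfl | ⟨g, hg⟩)
        exacts [⟨h, Or.inl ⟨rfl, rfl⟩⟩, ⟨g, Or.inr hg⟩]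
    have hfun : ∀ q g g', Sum.inr (q, g) ∈ S' → Sum.inr (q, g') ∈ S' → g = g' := by
      intro q g g' h1 h2
      rcases (hmem _ _).1 h1 with ⟨rfl, rfl⟩ | h1 <;> rcases (hmem _ _).1 h2 with ⟨hq, h2⟩ | h2
      · exact h2.symm
      · exact (hpS _ h2).elim
      · exact (hpS _ (hq ▸ h1)).elim
      · exact hS.functional q g g' h1 h2
    refine ⟨S', hSS', ⟨hfun, fun G' hG' => ?_, ?_⟩, ?_, ⟨h, (hmem _ _).2 (Or.inl ⟨rfl, rfl⟩)⟩⟩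
    · rw [hsets, hdom]
      rw [hdom] at hG'
      intro F hF Q hQ N
      refine (hRA F hF Q hQ N).congr fun q hq x _ => ?_
      have h1 := hG' q (hQ hq)
      by_cases hqp : q = p
      · subst hqp
        rw [Function.update_self, hfun q _ _ h1 ((hmem _ _).2 (Or.inl ⟨rfl, rfl⟩))]
      · rw [Function.update_of_ne hqp]
        have h2 := ((hmem _ _).1 h1).resolve_left fun hh => hqp hh.1
        rw [hGeq _ _ h2]
    · intro q r g k h1 h2 hqr
      have hA : Sum.inl A ∈ S' := Or.inl rfl
      rcases (hmem _ _).1 h1 with ⟨rfl, rfl⟩ | h1 <;> rcases (hmem _ _).1 h2 with ⟨hr, hk⟩ | h2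
      · exact (hqr.ne hr.symm).elim
      · obtain ⟨E, hE, hh⟩ := hfac r ⟨_, h2⟩
        rw [hGeq _ _ h2] at hh
        exact ⟨A, hA, E, hE, fun x hx y hy => (hh x hx y hy).2 hqr.le⟩
      · obtain ⟨E, hE, hh⟩ := hfac q ⟨_, h1⟩
        rw [hGeq _ _ h1] at hh
        subst hr hk
        exact ⟨A, hA, E, hE, fun x hx y hy => (hh x hx y hy).1 hqr.le⟩
      · obtain ⟨B, hB, hh⟩ := hS.factor q r g k h1 h2 hqr
        exact ⟨B, hSS' hB, hh⟩
    · refine (Set.Finite.countable (s := {Sum.inl A, Sum.inr (p, h)}) (by simp)).mono ?_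
      rintro x ⟨rfl | rfl | hx, hx'⟩
      · simp
      · simp
      · exact (hx' hx).elim
  · by_cases hyp : p ∈ domOf S ∧ q ∈ domOf S ∧ ¬ p ≤ q ∧ Monotone ψ ∧ ψ ∅ = ∅ ∧
      (∀ s k, k ∉ ψ s → ∃ B ∈ setsOf S, ∀ t : Finset ℕ, (t : Set ℕ) ⊆ G q '' B → k ∉ ψ (s ∪ t))
    · obtain ⟨hp, hq, hpq, hψ, hψ0, hψW⟩ := hyp
      obtain ⟨A, hA, hA1, hA2⟩ := hR.exists_diagonal hMA hW hDc hD hGtop hp hq hpq hψ hψ0 hψW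
      refine ⟨_, Set.subset_insert _ _, hS.insert_inl hG hA, hcnt _, ?_⟩
      intro h g h1 h2 _ _ _ _
      rw [← hGeq _ _ h1, ← hGeq _ _ h2]
      exact ⟨A, Or.inl rfl, hA1, hA2⟩
    · refine ⟨S, subset_rfl, hS, by simp, ?_⟩
      intro h g h1 h2 hpq hψ hψ0 hψW
      rw [← hGeq _ _ h2] at hψW
      exact (hyp ⟨⟨h, h1⟩, ⟨g, h2⟩, hpq, hψ, hψ0, hψW⟩).elim

theorem isGood_singleton_top : IsGood ({Sum.inr (⊤, id)} : Set (Fact J)) := by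
  refine ⟨fun p h h' => by simp +contextual, fun G hG F hF Q hQ N => ?_, ?_⟩
  · have hF0 : F = ∅ := Finset.eq_empty_of_forall_notMem fun A hA => by
      have := hF hA
      simp [setsOf] at this
    have hQ' : ∀ q ∈ Q, q = ⊤ ∧ G q = id := by
      intro q hq
      have := hG q (hQ hq)
      simpa using this
    refine ⟨fun t => t ⊤, fun t _ => by simp [hF0], fun q hq t t' _ _ => ?_⟩
    obtain ⟨rfl, h⟩ := hQ' q hq
    rw [h]
    refine ⟨fun h r hr _ => ?_, fun h => h _ hq le_rfl⟩
    obtain ⟨rfl, -⟩ := hQ' r hr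
    exact h
  · intro p q h g h1 h2 hpq
    simp only [Set.mem_singleton_iff, Sum.inr.injEq, Prod.mk.injEq] at h1 h2
    exact (hpq.ne (h1.1.trans h2.1.symm)).elim

/-- The outcome of the construction, before passing to ultrafilters. -/
theorem exists_system (hMA : MASigmaCentered) (hJ : #J ≤ continuum) :
    ∃ (W : Set (Set ℕ)) (G : J → ℕ → ℕ), G ⊤ = id ∧ Rich W Set.univ G ∧
      (∀ a, a ∈ W ∨ aᶜ ∈ W) ∧ (∀ p q, p < q → ∃ A ∈ W, FactorsOn A (G q) (G p)) ∧
      ∀ p q (ψ : Finset ℕ → Set ℕ), ¬ p ≤ q → Monotone ψ → ψ ∅ = ∅ →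
        (∀ s k, k ∉ ψ s → ∃ B ∈ W, ∀ t : Finset ℕ, (t : Set ℕ) ⊆ G q '' B → k ∉ ψ (s ∪ t)) →
        ∀ V ⊆ W, V.Countable → ∃ A ∈ W, (∀ B ∈ V, (A \ B).Finite) ∧
          ∀ s : Finset ℕ, (s : Set ℕ) ⊆ G q '' A → (ψ s).Nonempty → ∃ k ∈ ψ s, k ∉ G p '' A := by
  classical
  obtain ⟨S, hS₀, hS, hclosed⟩ := exists_closed_under_tasks (mk_task_le hJ) IsGood Fulfils
    {Sum.inr (⊤, id)} isGood_singleton_top (Set.countable_singleton _)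
    (fun C hne hC hg => IsGood.sUnion hne hC hg)
    (fun τ S hS hg hc => hg.exists_fulfils hMA τ (hS rfl) hc)
  obtain ⟨G, hG⟩ := exists_projections S
  have hdom : domOf S = Set.univ := by
    refine Set.eq_univ_of_forall fun p => ?_
    obtain ⟨T, T', -, -, -, hT', -, -, h⟩ :=
      hclosed (Sum.inr (Sum.inl p)) ∅ (by simp) Set.countable_empty
    obtain ⟨h, hh⟩ : p ∈ domOf T' := h
    exact ⟨h, hT' hh⟩
  have hGS : ∀ p, Sum.inr (p, G p) ∈ S := fun p => hG p (hdom ▸ Set.mem_univ p)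
  refine ⟨setsOf S, G, hS.functional ⊤ _ _ (hGS ⊤) (hS₀ rfl), hdom ▸ hS.rich G hG, fun a => ?_,
    fun p q hpq => hS.factor p q _ _ (hGS p) (hGS q) hpq, ?_⟩
  · obtain ⟨T, T', -, -, -, hT', -, -, h⟩ := hclosed (Sum.inl a) ∅ (by simp) Set.countable_empty
    exact Or.imp (fun h => hT' h) (fun h => hT' h) h
  · intro p q ψ hpq hψ hψ0 hψW V hV hVc
    choose! B hBW hB using hψW
    -- The task must be met at a stage where its hypotheses already hold. Only countably many
    -- witnesses `B s k` are needed, one for each `s` and `k`.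
    let D : Set (Fact J) := {Sum.inr (p, G p), Sum.inr (q, G q)} ∪ Sum.inl '' V ∪
      Sum.inl '' ((fun u : Finset ℕ × ℕ => B u.1 u.2) '' {u | u.2 ∉ ψ u.1})
    have hDS : D ⊆ S := by
      rintro x (((rfl | rfl) | ⟨A, hA, rfl⟩) | ⟨_, ⟨u, hu, rfl⟩, rfl⟩)
      · exact hGS p
      · exact hGS q
      · exact hV hA
      · exact hBW _ _ hu
    have hDc : D.Countable :=
      ((Set.Finite.countable (by simp)).union (hVc.image _)).union
        (((Set.to_countable _).image _).image _)
    obtain ⟨T, T', hDT, -, -, hT', -, -, h⟩ := hclosed (Sum.inr (Sum.inr (p, q, ψ))) D hDS hDc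
    obtain ⟨A, hA, hA1, hA2⟩ := h (G p) (G q) (hDT (by simp [D])) (hDT (by simp [D])) hpq hψ hψ0
      fun s k hk => ⟨B s k, hDT (Or.inr ⟨_, ⟨(s, k), hk, rfl⟩, rfl⟩), hB s k hk⟩
    exact ⟨A, hT' hA, fun C hC => hA1 C (hDT (Or.inl (Or.inr ⟨C, hC, rfl⟩))), hA2⟩

end System

end PPoints

/-! ### P-points, finitary Tukey reductions and the conclusion. -/

namespace PPoints

open Cardinal Filter

theorem IsPPoint.map {U : Ultrafilter ℕ} (hU : IsPPoint U) {g : ℕ → ℕ}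
    (hg : ((U.map g : Ultrafilter ℕ) : Filter ℕ) ≤ cofinite) : IsPPoint (U.map g) := by
  refine ⟨hg, fun f => ?_⟩
  obtain ⟨A, hA, h⟩ := hU.2 (f ∘ g)
  refine ⟨g '' A, Ultrafilter.mem_map.2 (mem_of_superset hA (Set.subset_preimage_image g A)), ?_⟩
  rcases h with h | ⟨c, hc⟩
  · refine Or.inl fun n => ((h n).image g).subset ?_
    rintro _ ⟨⟨x, hx, rfl⟩, hn⟩
    exact ⟨x, ⟨hx, hn⟩, rfl⟩
  · refine Or.inr ⟨c, ?_⟩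
    rintro _ ⟨x, hx, rfl⟩
    exact hc x hx

/-- The map `b ↦ f '' b` works, since `c ⊆ f ⁻¹' a` gives `f '' c ⊆ a`. -/
theorem RKReducible.tukeyReducible {U V : Ultrafilter ℕ}
    (h : RKReducible (U : Filter ℕ) (V : Filter ℕ)) :
    TukeyReducible (DirectedSet U) (DirectedSet V) := by
  obtain ⟨f, hf⟩ := h
  refine ⟨fun b => ⟨OrderDual.toDual (f '' OrderDual.ofDual b.1), ?_⟩, fun C hC a => ?_⟩
  · exact (hf _).2 (mem_of_superset b.2 (Set.subset_preimage_image f _))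
  · obtain ⟨c, hc, hac⟩ := hC ⟨OrderDual.toDual (f ⁻¹' OrderDual.ofDual a.1), (hf _).1 a.2⟩
    exact ⟨_, ⟨c, hc, rfl⟩, Set.image_subset_iff.2 hac⟩

theorem rkReducible_map_of_factors {U : Ultrafilter ℕ} {g h : ℕ → ℕ} {A : Set ℕ} (hA : A ∈ U)
    (hgh : ∀ x ∈ A, ∀ y ∈ A, g x = g y → h x = h y) :
    RKReducible ((U.map h : Ultrafilter ℕ) : Filter ℕ) ((U.map g : Ultrafilter ℕ) : Filter ℕ) := by
  classical
  have hf : ∀ n, ∃ m, ∀ x ∈ A, g x = n → h x = m := by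
    intro n
    by_cases hn : ∃ x ∈ A, g x = n
    · obtain ⟨x, hx, rfl⟩ := hn
      exact ⟨h x, fun y hy hyx => hgh y hy x hx hyx⟩
    · exact ⟨0, fun x hx hxn => (hn ⟨x, hx, hxn⟩).elim⟩
  choose f hf using hf
  refine ⟨f, fun a => ?_⟩
  change h ⁻¹' a ∈ U ↔ g ⁻¹' (f ⁻¹' a) ∈ U
  have key : ∀ x ∈ A, h x = f (g x) := fun x hx => hf _ x hx rfl
  constructor
  · intro ha
    filter_upwards [ha, hA] with x hx hxA
    rwa [Set.mem_preimage, Set.mem_preimage, ← key x hxA]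
  · intro ha
    filter_upwards [ha, hA] with x hx hxA
    rwa [Set.mem_preimage, key x hxA]

/-- A Tukey reduction between ultrafilters is witnessed by a monotone map with cofinal range. -/
theorem TukeyReducible.exists_monotone {U V : Ultrafilter ℕ}
    (h : TukeyReducible (DirectedSet U) (DirectedSet V)) :
    ∃ φ : Set ℕ → Set ℕ, Monotone φ ∧ (∀ b ∈ V, φ b ∈ U) ∧ ∀ c ∈ U, ∃ b ∈ V, φ b ⊆ c := by
  obtain ⟨g, hg⟩ := h
  let φ : Set ℕ → Set ℕ := fun b =>
    {k | ∃ b' : DirectedSet V, OrderDual.ofDual b'.1 ⊆ b ∧ k ∈ OrderDual.ofDual (g b').1}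
  refine ⟨φ, ?_, fun b hb => ?_, fun c hc => ?_⟩
  · rintro b b' hbb' k ⟨d, hd, hk⟩
    exact ⟨d, hd.trans hbb', hk⟩
  · exact mem_of_superset (g ⟨OrderDual.toDual b, hb⟩).2 fun k hk => ⟨_, subset_rfl, hk⟩
  · by_contra! hcon
    -- If no `φ b` is inside `c`, this set is cofinal, yet no member of its image lies inside `c`.
    let C : Set (DirectedSet V) := {b | ¬ OrderDual.ofDual (g b).1 ⊆ c}
    have hC : IsCofinal C := by
      intro b
      obtain ⟨k, ⟨b', hb', hk⟩, hkc⟩ := Set.not_subset.1 (hcon (OrderDual.ofDual b.1) b.2)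
      exact ⟨b', fun hh => hkc (hh hk), hb'⟩
    obtain ⟨_, ⟨b, hb, rfl⟩, hle⟩ := hg C hC ⟨OrderDual.toDual c, hc⟩
    exact hb hle

/-- In a P-point, a decreasing sequence `b n` has a diagonal `d` with `d \ n ⊆ b n` for infinitely
many `n`. -/
theorem IsPPoint.exists_diagonal {V : Ultrafilter ℕ} (hV : IsPPoint V) {b : ℕ → Set ℕ}
    (hb : ∀ n, b n ∈ V) :
    ∃ d ∈ V, ∀ m, ∃ n ≥ m, ∀ x ∈ d, n ≤ x → x ∈ b n := by
  classical
  have hgt : ∀ n, {x | n < x} ∈ V := fun n => hV.1 (by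
    rw [mem_cofinite]
    exact (Set.finite_Iic n).subset fun x hx => by simpa using hx)
  -- Finite-to-one on `A` means that `A` is almost contained in every `b n`; constancy is
  -- impossible. The clause `x ≤ n` makes the minimum exist.
  let f : ℕ → ℕ := fun x => if h : ∃ n, x ∉ b n ∨ x ≤ n then Nat.find h else 0
  have hex : ∀ x, ∃ n, x ∉ b n ∨ x ≤ n := fun x => ⟨x, Or.inr le_rfl⟩
  have hfspec : ∀ x, x ∉ b (f x) ∨ x ≤ f x := by
    intro x
    simp only [f, dif_pos (hex x)]
    exact Nat.find_spec (hex x)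
  have hfle : ∀ x n, x ∉ b n → f x ≤ n := by
    intro x n hx
    simp only [f, dif_pos (hex x)]
    exact Nat.find_min' _ (Or.inl hx)
  obtain ⟨A, hA, hfin | ⟨c, hc⟩⟩ := hV.2 f
  · have hbd : ∀ n, ∃ m, n < m ∧ ∀ x ∈ A, m ≤ x → x ∈ b n := by
      intro n
      have h1 : {x ∈ A | f x ≤ n}.Finite := by
        refine ((Set.finite_Iic n).biUnion fun i _ => hfin i).subset ?_
        rintro x ⟨hx, hxn⟩
        exact Set.mem_biUnion (x := f x) hxn ⟨hx, rfl⟩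
      obtain ⟨m, hm⟩ := h1.bddAbove
      refine ⟨max n m + 1, by omega, fun x hx hmx => ?_⟩
      by_contra hxb
      have := hm ⟨hx, hfle x n hxb⟩
      omega
    choose H hH hHb using hbd
    let e : ℕ → ℕ := fun i => H^[i] 0
    have he : ∀ i, e (i + 1) = H (e i) := fun i => Function.iterate_succ_apply' H i 0
    have hmono : StrictMono e := strictMono_nat_of_lt_succ fun i => (he i).symm ▸ hH _
    -- `V` contains either the even intervals or their complement. A subset of `A` that misses `[e
    -- i, e (i + 1))` lies in `b (e i)` from `e i` on.
    let Ev : Set ℕ := {x | ∃ i, e (2 * i) ≤ x ∧ x < e (2 * i + 1)}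
    have hlow : ∀ (d : Set ℕ) i, d ⊆ A → (∀ x ∈ d, ¬ (e i ≤ x ∧ x < e (i + 1))) →
        ∀ x ∈ d, e i ≤ x → x ∈ b (e i) := by
      intro d i hdA hd x hx hix
      refine hHb _ x (hdA hx) ?_
      rw [← he]
      by_contra! hlt
      exact hd x hx ⟨hix, hlt⟩
    rcases V.mem_or_compl_mem Ev with hE | hE
    · refine ⟨A ∩ Ev, inter_mem hA hE, fun m => ⟨e (2 * m + 1), ?_, ?_⟩⟩
      · exact (by omega : m ≤ 2 * m + 1).trans (hmono.id_le _)
      · refine hlow _ _ Set.inter_subset_left ?_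
        rintro x ⟨-, i, hi1, hi2⟩ ⟨h1, h2⟩
        have h3 := hmono.lt_iff_lt.1 (hi1.trans_lt h2)
        have h4 := hmono.lt_iff_lt.1 (h1.trans_lt hi2)
        omega
    · refine ⟨A ∩ Evᶜ, inter_mem hA hE, fun m => ⟨e (2 * m), ?_, ?_⟩⟩
      · exact (by omega : m ≤ 2 * m).trans (hmono.id_le _)
      · refine hlow _ _ Set.inter_subset_left ?_
        rintro x ⟨-, hx⟩ h
        exact hx ⟨m, h⟩
  · exfalso
    obtain ⟨x, ⟨hxA, hxb⟩, hxc⟩ := V.nonempty_of_mem (inter_mem (inter_mem hA (hb c)) (hgt c))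
    have := hfspec x
    rw [hc x hxA] at this
    rcases this with h | h
    · exact h hxb
    · exact absurd hxc (not_lt.2 h)

/-- Tukey reductions to P-points are finitary. -/
theorem TukeyReducible.exists_finitary {U V : Ultrafilter ℕ} (hU : (U : Filter ℕ) ≤ cofinite)
    (hV : IsPPoint V) (h : TukeyReducible (DirectedSet U) (DirectedSet V)) :
    ∃ ψ : Finset ℕ → Set ℕ, Monotone ψ ∧ ψ ∅ = ∅ ∧
      (∀ s k, k ∉ ψ s → ∃ b ∈ V, ∀ t : Finset ℕ, (t : Set ℕ) ⊆ b → k ∉ ψ (s ∪ t)) ∧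
      (∀ a ∈ V, ∃ s : Finset ℕ, (s : Set ℕ) ⊆ a ∧ (ψ s).Nonempty) ∧
      ∀ c ∈ U, ∃ b ∈ V, ∀ s : Finset ℕ, (s : Set ℕ) ⊆ b → ψ s ⊆ c := by
  classical
  obtain ⟨φ, hφ, hφU, hφc⟩ := h.exists_monotone
  -- The points that `s` alone forces into `φ b`.
  let ψ : Finset ℕ → Set ℕ := fun s => {k | ∀ b ∈ V, (s : Set ℕ) ⊆ b → k ∈ φ b}
  refine ⟨ψ, ?_, ?_, ?_, ?_, ?_⟩
  · intro s t hst k hk b hb htb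
    exact hk b hb ((Finset.coe_subset.2 hst).trans htb)
  · refine Set.eq_empty_of_forall_notMem fun k hk => ?_
    obtain ⟨b, hb, hbk⟩ := hφc {k}ᶜ (hU (by simp))
    exact hbk (hk b hb (by simp)) rfl
  · intro s k hk
    simp only [ψ, Set.mem_ofPred_eq, not_forall] at hk
    obtain ⟨b, hb, hsb, hkb⟩ := hk
    refine ⟨b, hb, fun t htb hkt => hkb (hkt b hb ?_)⟩
    rw [Finset.coe_union]
    exact Set.union_subset hsb htb
  · intro a ha
    by_contra! hcon
    have hch : ∀ (s : Finset ℕ) (k : ℕ), ∃ b ∈ V, (s : Set ℕ) ⊆ a → (s : Set ℕ) ⊆ b ∧ k ∉ φ b := by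
      intro s k
      by_cases hs : (s : Set ℕ) ⊆ a
      · have hk : k ∉ ψ s := by simp [hcon s hs]
        simp only [ψ, Set.mem_ofPred_eq, not_forall] at hk
        obtain ⟨b, hb, hsb, hkb⟩ := hk
        exact ⟨b, hb, fun _ => ⟨hsb, hkb⟩⟩
      · exact ⟨a, ha, fun hh => (hs hh).elim⟩
    choose b hbV hb using hch
    -- For `k ∈ φ (d ∩ a)`, take `n > k` with `d \ n` inside the `n`-th set, and `s = d ∩ a ∩ n`.
    -- Then `d ∩ a ⊆ b s k`, so `k ∈ φ (b s k)`, against the choice of `b s k`.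
    obtain ⟨d, hd, hdiag⟩ := hV.exists_diagonal
      (b := fun n => ⋂ s ∈ (Finset.range n).powerset, ⋂ k ∈ Finset.range n, b s k) fun n => by
        rw [← Ultrafilter.mem_coe, biInter_finset_mem]
        intro s _
        rw [biInter_finset_mem]
        exact fun k _ => hbV s k
    have hda : d ∩ a ∈ V := inter_mem hd ha
    obtain ⟨k, hk⟩ := U.nonempty_of_mem (hφU _ hda)
    obtain ⟨n, hn, hdn⟩ := hdiag (k + 1)
    let s := (Finset.range n).filter (· ∈ d ∩ a)
    have hsa : (s : Set ℕ) ⊆ a := fun x hx => (Finset.mem_filter.1 (Finset.mem_coe.1 hx)).2.2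
    refine (hb s k hsa).2 (hφ ?_ hk)
    intro x hx
    by_cases hxn : x < n
    · exact (hb s k hsa).1 (Finset.mem_coe.2 (Finset.mem_filter.2 ⟨Finset.mem_range.2 hxn, hx⟩))
    · have := hdn x hx.1 (not_lt.1 hxn)
      simp only [Set.mem_iInter] at this
      exact this s (Finset.mem_powerset.2 (Finset.filter_subset _ _)) k
        (Finset.mem_range.2 (Nat.lt_of_succ_le hn))
  · intro c hc
    obtain ⟨b, hb, hbc⟩ := hφc c hc
    exact ⟨b, hb, fun s hs k hk => hbc (hk b hb hs)⟩

/-- The theorem for orders in the lowest universe. -/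
theorem exists_ppoints (hMA : MASigmaCentered) {I : Type} [PartialOrder I]
    (hI : #I ≤ continuum) :
    ∃ φ : I → Ultrafilter ℕ, (∀ p, IsPPoint (φ p)) ∧
      (∀ p q, p ≤ q → RKReducible (φ p : Filter ℕ) (φ q : Filter ℕ)) ∧
      ∀ p q, TukeyReducible (DirectedSet (φ p)) (DirectedSet (φ q)) → p ≤ q := by
  classical
  rcases isEmpty_or_nonempty I with hem | ⟨⟨i₀⟩⟩
  · exact ⟨fun p => (hem.false p).elim, fun p => (hem.false p).elim, fun p => (hem.false p).elim,
      fun p => (hem.false p).elim⟩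
  have hJ : #(WithTop I) ≤ continuum := by
    refine (mk_option (α := I)).trans_le ?_
    exact add_le_of_le aleph0_le_continuum hI (one_le_aleph0.trans aleph0_le_continuum)
  obtain ⟨W, G, hGtop, hR, hdec, hfac, hdiag⟩ := exists_system (J := WithTop I) hMA hJ
  -- A cube of side `2` shows that no projection is constant on a set of `W`; this makes the images
  -- non-principal.
  have hcube : ∀ A ∈ W, ∀ p : WithTop I, ∃ x ∈ A, ∃ y ∈ A, G p x ≠ G p y := by
    intro A hA p
    obtain ⟨c, hc⟩ := hR {A} (by simpa using hA) {p} (by simp) 2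
    refine ⟨c fun _ => 0, ?_, c fun _ => 1, ?_, fun h => ?_⟩
    · simpa using hc.1 (fun _ => 0) (by simp)
    · simpa using hc.1 (fun _ => 1) (by simp)
    · have := (hc.2 p (by simp) _ _ (by simp) (by simp)).1 h p (by simp) le_rfl
      simp at this
  have hne : (Filter.generate W).NeBot := by
    rw [Filter.generate_neBot_iff]
    intro t htW ht
    obtain ⟨c, hc⟩ := hR ht.toFinset (by simpa using htW) ∅ (by simp) 1
    exact ⟨_, by simpa using hc.1 (fun _ => 0) (by simp)⟩
  let U : Ultrafilter ℕ := Ultrafilter.of (Filter.generate W)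
  have hWU : ∀ A ∈ W, A ∈ U := fun A hA => Ultrafilter.of_le _ (Filter.mem_generate_of_mem hA)
  have hUW : ∀ A, A ∈ U ↔ A ∈ W := by
    refine fun A => ⟨fun hA => ?_, hWU A⟩
    refine (hdec A).resolve_right fun h => ?_
    exact Ultrafilter.compl_notMem_iff.2 hA (hWU _ h)
  have hcof : ∀ p, ((U.map (G p) : Ultrafilter ℕ) : Filter ℕ) ≤ cofinite := by
    intro p
    rw [le_cofinite_iff_compl_singleton_mem]
    intro n
    change G p ⁻¹' {n}ᶜ ∈ U
    rw [Set.preimage_compl, Ultrafilter.compl_mem_iff_notMem, hUW]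
    intro h
    obtain ⟨x, hx, y, hy, hxy⟩ := hcube _ h p
    exact hxy (hx.trans hy.symm)
  have hUcof : (U : Filter ℕ) ≤ cofinite := by
    have := hcof ⊤
    rwa [hGtop, Ultrafilter.map_id] at this
  have hUP : IsPPoint U := by
    refine ⟨hUcof, fun f => ?_⟩
    by_cases hc : ∃ c, f ⁻¹' {c} ∈ U
    · obtain ⟨c, hc⟩ := hc
      exact ⟨_, hc, Or.inr ⟨c, fun k hk => hk⟩⟩
    push Not at hc
    -- With `ψ` empty the diagonalization is void and only the pseudo-intersection remains. The
    -- added top supplies the required pair `⊤ ≰ i₀`.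
    obtain ⟨A, hA, hAV, -⟩ := hdiag ⊤ (i₀ : WithTop I) (fun _ => ∅) (by simp) monotone_const rfl
      (fun s k _ => by
        refine ⟨Set.univ, ?_, by simp⟩
        rw [← hUW]; exact univ_mem)
      (Set.range fun c => (f ⁻¹' {c})ᶜ) (by
        rintro _ ⟨c, rfl⟩
        rw [← hUW]
        exact Ultrafilter.compl_mem_iff_notMem.2 (hc c)) (Set.countable_range _)
    refine ⟨A, hWU A hA, Or.inl fun n => (hAV _ ⟨n, rfl⟩).subset ?_⟩
    rintro k ⟨hk, hkn⟩
    exact ⟨hk, fun h => h hkn⟩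
  have hP : ∀ p, IsPPoint (U.map (G p)) := fun p => hUP.map (hcof p)
  refine ⟨fun p => U.map (G p), fun p => hP p, fun p q hpq => ?_, fun p q hT => ?_⟩
  · rcases hpq.eq_or_lt with rfl | hlt
    · exact ⟨id, fun a => Iff.rfl⟩
    · obtain ⟨A, hA, E, hE, h⟩ := hfac p q (WithTop.coe_lt_coe.2 hlt)
      refine rkReducible_map_of_factors (A := A \ E) ?_ h
      exact inter_mem (hWU A hA) (hUcof hE.compl_mem_cofinite)
  · by_contra hpq
    obtain ⟨ψ, hψ, hψ0, hψV, hψne, hψc⟩ := hT.exists_finitary (hcof p) (hP q)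
    obtain ⟨A, hA, -, hAψ⟩ := hdiag p q ψ (by simpa using hpq) hψ hψ0 (fun s k hk => by
      obtain ⟨b, hb, h⟩ := hψV s k hk
      exact ⟨G q ⁻¹' b, (hUW _).1 hb, fun t ht => h t (ht.trans (Set.image_preimage_subset _ _))⟩)
      ∅ (by simp) Set.countable_empty
    have himg : ∀ r, G r '' A ∈ U.map (G r) := fun r =>
      Ultrafilter.mem_map.2 (mem_of_superset (hWU A hA) (Set.subset_preimage_image _ _))
    -- Below `b`, every `ψ s` lies in `G p '' A`; a nonempty `ψ s` with `s ⊆ b ∩ G q '' A`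
    -- contradicts the choice of `A`.
    obtain ⟨b, hb, hbc⟩ := hψc (G p '' A) (himg p)
    obtain ⟨s, hs, hsne⟩ := hψne (b ∩ G q '' A) (inter_mem hb (himg q))
    obtain ⟨k, hk, hkA⟩ := hAψ s (hs.trans Set.inter_subset_right) hsne
    exact hkA (hbc s (hs.trans Set.inter_subset_left) hk)

end PPoints

theorem mainTheorem2 (hMA : PPoints.MASigmaCentered)
    {P : Type*} [PartialOrder P] (hP : Cardinal.mk P ≤ Cardinal.continuum) :
    ∃ φ : P → Ultrafilter ℕ,
      (∀ p : P, PPoints.IsPPoint (φ p)) ∧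
      (∀ p q : P, p ≤ q ↔ PPoints.RKReducible (φ p : Filter ℕ) (φ q : Filter ℕ)) ∧
      (∀ p q : P, p ≤ q ↔
        PPoints.TukeyReducible (PPoints.DirectedSet (φ p)) (PPoints.DirectedSet (φ q))) := by
  -- The order is copied to a subset of `Set ℕ`, which lies in the universe where Martin's axiom is
  -- stated.
  have hsmall : Cardinal.lift.{0} (Cardinal.mk P) ≤ Cardinal.lift (Cardinal.mk (Set ℕ)) := by
    simpa using hP
  obtain ⟨e⟩ := Cardinal.lift_mk_le'.1 hsmall
  obtain ⟨I, ⟨f⟩, hI⟩ : ∃ I : Type, Nonempty (P ≃ I) ∧ Cardinal.mk I ≤ Cardinal.continuum :=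
    ⟨Set.range e, ⟨Equiv.ofInjective e e.injective⟩, (Cardinal.mk_set_le _).trans (by simp)⟩
  let _ : PartialOrder I := PartialOrder.lift f.symm f.symm.injective
  have hle : ∀ p q, f p ≤ f q ↔ p ≤ q := fun p q => by
    change f.symm (f p) ≤ f.symm (f q) ↔ p ≤ q
    simp
  obtain ⟨φ, h1, h2, h3⟩ := PPoints.exists_ppoints hMA hI
  refine ⟨fun p => φ (f p), fun p => h1 _, fun p q => ⟨fun h => h2 _ _ ((hle p q).2 h),
    fun h => (hle p q).1 (h3 _ _ h.tukeyReducible)⟩,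
    fun p q => ⟨fun h => (h2 _ _ ((hle p q).2 h)).tukeyReducible,
    fun h => (hle p q).1 (h3 _ _ h)⟩⟩
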